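/- Let $-\infty\le a<b\le\infty$ and let $p,q,r$ be real-valued Lebesgue measurable functions on $(a,b)$ with $p,r>0$ a.e. and $r,\,1/p,\,q\in L^1_{loc}((a,b);dx)$. For $y\in AC_{loc}((a,b))$ write $y^{[1]}=p\,y'$, and set $$\tau=\frac1r\Big[-\frac{d}{dx}\,p\,\frac{d}{dx}+q\Big]$$ on $(a,b)$. In the complex Hilbert space $L^2_r:=L^2((a,b);r\,dx)$ define the maximal operator $T_{max}f=\tau f$ on $$\mathcal D(T_{max})=\{g\in L^2_r : g,\,g^{[1]}\in AC_{loc}((a,b)),\ \tau g\in L^2_r\},$$ the preminimal operator $T_{min,0}$ as the restriction of $T_{max}$ to those $g\in\mathcal D(T_{max})$ whose support is a compact subset of $(a,b)$, and the minimal operator $T_{min}=\overline{T_{min,0}}$. Let $[a,b]$ denote the set of real $x$ with $a\le x\le b$ (so infinite endpoints are not included). Let $A$ be a real-valued function with $A,\,A^{[1]}\in AC([a,b])$ (understood as $AC_{loc}$ near an infinite endpoint), let $\phi\in C^2([a,b])$ be real-valued with $\phi'(x)\ne0$ for all $x\in[a,b]$, and let $\phi$ fix the endpoints: $\phi(d)=d$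 for $d\in\{a,b\}$, where for an infinite endpoint this means $\phi(x)\to d$ as $x\to d$. Suppose that $A\neq 0$ on $(a,b)$, that $A^2/\phi'$ and $\phi'/A^2$ are bounded above on $(a,b)$, and that for some constant $C>0$ and a.e. $x\in(a,b)$ \begin{align*} r(x)&=C\,r(\phi^{-1}(x)),\\ p(x)&=[A(\phi^{-1}(x))]^2\,\phi'(\phi^{-1}(x))\,p(\phi^{-1}(x)),\\ q(x)&=\frac{A(\phi^{-1}(x))}{\phi'(\phi^{-1}(x))}\Big\{A(\phi^{-1}(x))\,q(\phi^{-1}(x))-\big(A^{[1]}\big)'(\phi^{-1}(x))\Big\}. \end{align*} Then $(Kf)(x)=A(x)f(\phi(x))$ defines a bounded and boundedly invertible operator $K$ in $L^2_r$, and $T_{min,0}$, $T_{min}$ and $T_{max}$ are all $K$-invariant: each of these operators $T$ is densely defined and closable, and $K^*TK=T$, that is, $\{f\in L^2_r: Kf\in\mathcal D(T)\}=\mathcal D(T)$ and $K^*TKf=Tf$ for all $f\in\mathcal D(T)$. -/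

import Mathlib

open MeasureTheory Filter Set
open scoped ENNReal Topology

noncomputable section

namespace SturmLiouville

/-! ### `K`-invariance of an unbounded operator -/

section Abstract

variable {H : Type*} [NormedAddCommGroup H] [InnerProductSpace ℂ H] [CompleteSpace H]

/-- The operator `K* T K` with its natural domain `{f | K f ∈ D(T)}`. -/
def conjOp (K : H →L[ℂ] H) (T : H →ₗ.[ℂ] H) : H →ₗ.[ℂ] H where
  domain := T.domain.comap (K : H →ₗ[ℂ] H)
  toFun := (ContinuousLinearMap.adjoint K : H →ₗ[ℂ] H) ∘ₗ T.toFun ∘ₗ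
    ((K : H →ₗ[ℂ] H).restrict (p := T.domain.comap (K : H →ₗ[ℂ] H)) (q := T.domain)
      (fun _ hx => hx))

/-- `T` is `K`-invariant: `K` is bounded and boundedly invertible, `T` is densely defined and
closable, and `K* T K = T` as unbounded operators (equal domains and equal action). -/
structure KInvariant (K : H →L[ℂ] H) (T : H →ₗ.[ℂ] H) : Prop where
  isUnit : IsUnit K
  dense_domain : Dense (T.domain : Set H)
  isClosable : T.IsClosable
  conj_eq : conjOp K T = T

end Abstract

/-! ### Intervals and absolute continuity -/

/-- The open interval `(a, b)` of real numbers with possibly infinite endpoints. -/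
def openI (a b : EReal) : Set ℝ := {x | a < (x : EReal) ∧ (x : EReal) < b}

/-- The set `[a, b] ∩ ℝ`: finite endpoints belong to it, infinite ones do not. -/
def closedI (a b : EReal) : Set ℝ := {x | a ≤ (x : EReal) ∧ (x : EReal) ≤ b}

/-- `f` is absolutely continuous on every compact interval `[c, d]` with `c, d ∈ s`. For
`s = openI a b` this is `AC_loc((a, b))`; for `s = closedI a b` this is `AC([a, b])`, with `AC_loc`
near infinite endpoints. -/
def ACLoc {E : Type*} [NormedAddCommGroup E] (s : Set ℝ) (f : ℝ → E) : Prop :=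
  ∀ c ∈ s, ∀ d ∈ s, AbsolutelyContinuousOnInterval f c d

/-- `y₁` is (a representative of) the quasi-derivative `p y'` of `y` on `(a, b)`. -/
def IsQuasiDeriv {E : Type*} [NormedAddCommGroup E] [NormedSpace ℝ E] (a b : EReal)
    (p : ℝ → ℝ) (y y₁ : ℝ → E) : Prop :=
  ∀ᵐ x ∂(volume.restrict (openI a b)), y₁ x = p x • deriv y x

/-! ### The Sturm–Liouville operators -/

/-- The standing assumptions on the coefficients of
`τ = (1 / r) [-(d/dx) p (d/dx) + q]` on `(a, b)`. -/
structure IsCoefficients (a b : EReal) (p q r : ℝ → ℝ) : Prop where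
  lt : a < b
  aemeasurable_p : AEMeasurable p (volume.restrict (openI a b))
  aemeasurable_q : AEMeasurable q (volume.restrict (openI a b))
  aemeasurable_r : AEMeasurable r (volume.restrict (openI a b))
  p_pos : ∀ᵐ x ∂(volume.restrict (openI a b)), 0 < p x
  r_pos : ∀ᵐ x ∂(volume.restrict (openI a b)), 0 < r x
  locInt_r : LocallyIntegrableOn r (openI a b)
  locInt_inv_p : LocallyIntegrableOn (fun x => 1 / p x) (openI a b)
  locInt_q : LocallyIntegrableOn q (openI a b)

/-- The measure `r dx` on `(a, b)`. -/
def weight (a b : EReal) (r : ℝ → ℝ) : Measure ℝ :=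
  (volume.restrict (openI a b)).withDensity (fun x => ENNReal.ofReal (r x))

/-- The complex Hilbert space `L²((a, b); r dx)`. -/
abbrev L2 (a b : EReal) (r : ℝ → ℝ) : Type := Lp ℂ 2 (weight a b r)

/-- `f` and `g` are elements of `L²((a, b); r dx)` such that `f, f^{[1]} ∈ AC_loc((a, b))` and
`g = τ f`. -/
def TauRel (a b : EReal) (p q r : ℝ → ℝ) (f g : L2 a b r) : Prop :=
  ∃ y y₁ : ℝ → ℂ, f =ᵐ[weight a b r] y ∧ ACLoc (openI a b) y ∧ ACLoc (openI a b) y₁ ∧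
    IsQuasiDeriv a b p y y₁ ∧
    g =ᵐ[weight a b r] fun x => (1 / r x) • (-deriv y₁ x + q x • y x)

lemma ordConnected_openI (a b : EReal) : (openI a b).OrdConnected := by
  refine ⟨fun x hx y hy z hz => ⟨lt_of_lt_of_le hx.1 ?_, lt_of_le_of_lt ?_ hy.2⟩⟩
  · exact_mod_cast hz.1
  · exact_mod_cast hz.2

lemma isOpen_openI (a b : EReal) : IsOpen (openI a b) :=
  (isOpen_Ioi.preimage continuous_coe_real_ereal).inter
    (isOpen_Iio.preimage continuous_coe_real_ereal)

lemma ae_restrict_openI_of_rat {a b : EReal} {P : ℝ → Prop}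
    (h : ∀ c ∈ openI a b, ∀ d ∈ openI a b, ∀ᵐ x, x ∈ uIcc c d → P x) :
    ∀ᵐ x ∂(volume.restrict (openI a b)), P x := by
  rw [ae_restrict_iff' (isOpen_openI a b).measurableSet]
  have h2 : ∀ c d : ℚ, ∀ᵐ x : ℝ, (c : ℝ) ∈ openI a b → (d : ℝ) ∈ openI a b →
      x ∈ uIcc (c : ℝ) d → P x := by
    intro c d
    by_cases hc : (c : ℝ) ∈ openI a b
    · by_cases hd : (d : ℝ) ∈ openI a b
      · filter_upwards [h c hc d hd] with x hx _ _ using hx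
      · simp [hd]
    · simp [hc]
  filter_upwards [ae_all_iff.2 fun c => ae_all_iff.2 (h2 c)] with x hx hxI
  obtain ⟨ε, hε, hb⟩ := Metric.isOpen_iff.1 (isOpen_openI a b) x hxI
  obtain ⟨c, hc1, hc2⟩ := exists_rat_btwn (show x - ε < x by linarith)
  obtain ⟨d, hd1, hd2⟩ := exists_rat_btwn (show x < x + ε by linarith)
  refine hx c d (hb ?_) (hb ?_) ?_
  · rw [Real.ball_eq_Ioo]; exact ⟨hc1, by linarith⟩
  · rw [Real.ball_eq_Ioo]; exact ⟨by linarith, hd2⟩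
  · exact Icc_subset_uIcc ⟨hc2.le, hd1.le⟩

lemma ACLoc.ae_differentiableAt {a b : EReal} {y : ℝ → ℂ} (h : ACLoc (openI a b) y) :
    ∀ᵐ x ∂(volume.restrict (openI a b)), DifferentiableAt ℝ y x :=
  ae_restrict_openI_of_rat fun c hc d hd => 
    BoundedVariationOn.ae_differentiableAt_of_mem_uIcc (h c hc d hd).boundedVariationOn

lemma ACLoc.continuousOn {a b : EReal} {y : ℝ → ℂ} (h : ACLoc (openI a b) y) :
    ContinuousOn y (openI a b) := by
  intro x hxI
  obtain ⟨ε, hε, hb⟩ := Metric.isOpen_iff.1 (isOpen_openI a b) x hxI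
  have hc : x - ε / 2 ∈ openI a b := hb (by rw [Real.ball_eq_Ioo]; constructor <;> linarith)
  have hd : x + ε / 2 ∈ openI a b := hb (by rw [Real.ball_eq_Ioo]; constructor <;> linarith)
  have := (h _ hc _ hd).continuousOn
  rw [uIcc_of_le (by linarith)] at this
  exact (this.continuousAt (Icc_mem_nhds (by linarith) (by linarith))).continuousWithinAt

/-- The relation `g = τ f` as a linear subspace of `L² × L²`. -/
def maxGraph (a b : EReal) (p q r : ℝ → ℝ) : Submodule ℂ (L2 a b r × L2 a b r) where
  carrier := {z | TauRel a b p q r z.1 z.2}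
  zero_mem' := by
    refine ⟨0, 0, Lp.coeFn_zero _ _ _, ?_, ?_, ?_, ?_⟩
    · exact fun c _ d _ =>
        (LipschitzWith.const (0 : ℂ)).lipschitzOnWith.absolutelyContinuousOnInterval
    · exact fun c _ d _ =>
        (LipschitzWith.const (0 : ℂ)).lipschitzOnWith.absolutelyContinuousOnInterval
    · exact Eventually.of_forall fun x => by
        have h0 : deriv (0 : ℝ → ℂ) x = 0 := deriv_const x (0 : ℂ)
        simp [h0]
    · filter_upwards [Lp.coeFn_zero ℂ 2 (weight a b r)] with x hx
      have h0 : deriv (0 : ℝ → ℂ) x = 0 := deriv_const x (0 : ℂ)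
      simpa [h0] using hx
  add_mem' := by
    rintro ⟨f, g⟩ ⟨f', g'⟩ ⟨y, y₁, hf, hy, hy₁, hq, hg⟩ ⟨z, z₁, hf', hz, hz₁, hq', hg'⟩
    refine ⟨y + z, y₁ + z₁, ?_, ?_, ?_, ?_, ?_⟩
    · filter_upwards [hf, hf', Lp.coeFn_add f f'] with x h1 h2 h3
      exact h3.trans (by rw [Pi.add_apply, Pi.add_apply]; exact congrArg₂ (· + ·) h1 h2)
    · exact fun c hc d hd => (hy c hc d hd).add (hz c hc d hd)
    · exact fun c hc d hd => (hy₁ c hc d hd).add (hz₁ c hc d hd)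
    · filter_upwards [hq, hq', hy.ae_differentiableAt, hz.ae_differentiableAt] with x h1 h2 h3 h4
      rw [deriv_add h3 h4, Pi.add_apply, h1, h2, smul_add]
    · have hac : weight a b r ≪ volume.restrict (openI a b) := withDensity_absolutelyContinuous _ _
      filter_upwards [hg, hg', Lp.coeFn_add g g', hac.ae_le hy₁.ae_differentiableAt,
        hac.ae_le hz₁.ae_differentiableAt] with x h1 h2 h3 h4 h5
      change (g + g') x = _
      rw [h3, deriv_add h4 h5, Pi.add_apply, h1, h2, Pi.add_apply, ← smul_add]
      congr 1
      rw [smul_add]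
      abel
  smul_mem' := by
    rintro k ⟨f, g⟩ ⟨y, y₁, hf, hy, hy₁, hq, hg⟩
    refine ⟨k • y, k • y₁, ?_, ?_, ?_, ?_, ?_⟩
    · filter_upwards [hf, Lp.coeFn_smul k f] with x h1 h3
      change (k • f) x = _
      simp [h3, h1]
    · exact fun c hc d hd => (hy c hc d hd).const_smul k
    · exact fun c hc d hd => (hy₁ c hc d hd).const_smul k
    · filter_upwards [hq] with x h1
      rw [deriv_const_smul_field, Pi.smul_apply, h1, smul_comm]
    · filter_upwards [hg, Lp.coeFn_smul k g] with x h1 h3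
      change (k • g) x = _
      rw [h3, deriv_const_smul_field, Pi.smul_apply, h1, Pi.smul_apply, smul_comm k (1 / r x),
        smul_comm (q x) k, smul_add, smul_neg]

lemma eqOn_zero_of_ae {a b : EReal} {y : ℝ → ℂ} (hy : ContinuousOn y (openI a b))
    (h : ∀ᵐ x ∂(volume.restrict (openI a b)), y x = 0) : EqOn y 0 (openI a b) :=
  Measure.eqOn_open_of_ae_eq (μ := volume) h (isOpen_openI a b) hy continuousOn_const

/-- `τ f` is uniquely determined by `f`, so that `maxGraph` really is the graph of an operator. -/
lemma maxGraph_functional {a b : EReal} {p q r : ℝ → ℝ} (h : IsCoefficients a b p q r) :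
    ∀ z : L2 a b r × L2 a b r, z ∈ maxGraph a b p q r → z.1 = 0 → z.2 = 0 := by
  rintro ⟨f, g⟩ ⟨y, y₁, hf, hy, hy₁, hq, hg⟩ (rfl : f = 0)
  have hac : volume.restrict (openI a b) ≪ weight a b r :=
    withDensity_absolutelyContinuous' h.aemeasurable_r.ennreal_ofReal
      (h.r_pos.mono fun x hx => by simpa using hx)
  have hac' : weight a b r ≪ volume.restrict (openI a b) := withDensity_absolutelyContinuous _ _
  have key : ∀ w : ℝ → ℂ, EqOn w 0 (openI a b) → ∀ x ∈ openI a b, deriv w x = 0 := by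
    intro w hw x hx
    have : w =ᶠ[𝓝 x] fun _ => (0 : ℂ) := hw.eventuallyEq_of_mem ((isOpen_openI a b).mem_nhds hx)
    rw [this.deriv_eq, deriv_const]
  have hy0 : EqOn y 0 (openI a b) := eqOn_zero_of_ae hy.continuousOn <| by
    filter_upwards [hac.ae_le hf, hac.ae_le (Lp.coeFn_zero ℂ 2 (weight a b r))] with x h1 h2
    rw [← h1]; exact h2
  have hmem := ae_restrict_mem (μ := volume) (isOpen_openI a b).measurableSet
  have hy₁0 : EqOn y₁ 0 (openI a b) := eqOn_zero_of_ae hy₁.continuousOn <| by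
    filter_upwards [hq, hmem] with x h1 h2
    rw [h1, key y hy0 x h2, smul_zero]
  refine Lp.ext ?_
  filter_upwards [hg, Lp.coeFn_zero ℂ 2 (weight a b r), hac'.ae_le hmem] with x h1 h2 h3
  rw [h1, h2, key y₁ hy₁0 x h3, hy0 h3]
  simp

/-- The maximal operator: `T_max f = τ f` on
`{f ∈ L² | f, f^{[1]} ∈ AC_loc((a, b)), τ f ∈ L²}`. -/
def Tmax (a b : EReal) (p q r : ℝ → ℝ) : L2 a b r →ₗ.[ℂ] L2 a b r :=
  (maxGraph a b p q r).toLinearPMap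

/-- The defining property of `T_max`: `f ∈ D(T_max)` and `T_max f = g` iff `g = τ f`. -/
lemma mem_graph_Tmax {a b : EReal} {p q r : ℝ → ℝ} (h : IsCoefficients a b p q r)
    (f g : L2 a b r) : (f, g) ∈ (Tmax a b p q r).graph ↔ TauRel a b p q r f g := by
  rw [Tmax, Submodule.toLinearPMap_graph_eq _ (maxGraph_functional h)]
  rfl

/-- The elements of `L²((a, b); r dx)` whose (essential) support is a compact subset of `(a, b)`. -/
def compactlySupported (a b : EReal) (r : ℝ → ℝ) : Submodule ℂ (L2 a b r) where
  carrier := {f | ∃ S : Set ℝ, IsCompact S ∧ S ⊆ openI a b ∧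
    ∀ᵐ x ∂(weight a b r), x ∉ S → f x = 0}
  zero_mem' := ⟨∅, isCompact_empty, empty_subset _, by
    filter_upwards [Lp.coeFn_zero ℂ 2 (weight a b r)] with x hx _ using hx⟩
  add_mem' := by
    rintro f g ⟨S, hS, hSI, hf⟩ ⟨S', hS', hSI', hg⟩
    refine ⟨S ∪ S', hS.union hS', union_subset hSI hSI', ?_⟩
    filter_upwards [hf, hg, Lp.coeFn_add f g] with x h1 h2 h3 hx
    rw [h3, Pi.add_apply, h1 fun h => hx (Or.inl h), h2 fun h => hx (Or.inr h), add_zero]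
  smul_mem' := by
    rintro k f ⟨S, hS, hSI, hf⟩
    refine ⟨S, hS, hSI, ?_⟩
    filter_upwards [hf, Lp.coeFn_smul k f] with x h1 h3 hx
    rw [h3, Pi.smul_apply, h1 hx, smul_zero]

/-- The preminimal operator: the restriction of `T_max` to the functions in `D(T_max)` that have
compact support in `(a, b)`. -/
def Tmin0 (a b : EReal) (p q r : ℝ → ℝ) : L2 a b r →ₗ.[ℂ] L2 a b r :=
  (Tmax a b p q r).domRestrict (compactlySupported a b r)

/-- The minimal operator: the closure of the preminimal operator. -/
def Tmin (a b : EReal) (p q r : ℝ → ℝ) : L2 a b r →ₗ.[ℂ] L2 a b r :=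
  (Tmin0 a b p q r).closure

/-! ### The operator `K` and the assumptions on `A` and `φ` -/

/-- `K` is the operator `(K f)(x) = A(x) f(φ(x))` in `L²((a, b); r dx)`. -/
def IsWeightedComposition {a b : EReal} {r : ℝ → ℝ} (A φ : ℝ → ℝ)
    (K : L2 a b r →L[ℂ] L2 a b r) : Prop :=
  ∀ f : L2 a b r, K f =ᵐ[weight a b r] fun x => A x • f (φ x)

/-- `φ(d) = d` for `d ∈ {a, b}`, read as a limit at an infinite endpoint. -/
def FixesEndpoints (a b : EReal) (φ : ℝ → ℝ) : Prop :=
  (∀ d : ℝ, (d : EReal) = a ∨ (d : EReal) = b → φ d = d) ∧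
    (a = ⊥ → Tendsto φ atBot atBot) ∧ (b = ⊤ → Tendsto φ atTop atTop)

/-- The assumptions on `A`, its quasi-derivative `A₁ = A^{[1]} = p A'`, and `φ`. The bounds are
those of `A² / φ'` and `φ' / A²` on `(a, b)`; the second quotient requires `A ≠ 0` there. -/
structure IsTransformation (a b : EReal) (p A A₁ φ : ℝ → ℝ) : Prop where
  ac_A : ACLoc (closedI a b) A
  ac_A₁ : ACLoc (closedI a b) A₁
  quasiDeriv : IsQuasiDeriv a b p A A₁
  contDiffOn : ContDiffOn ℝ 2 φ (closedI a b)
  deriv_ne_zero : ∀ x ∈ closedI a b, derivWithin φ (closedI a b) x ≠ 0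
  fixes : FixesEndpoints a b φ
  A_ne_zero : ∀ x ∈ openI a b, A x ≠ 0
  bdd : BddAbove ((fun x => A x ^ 2 / deriv φ x) '' openI a b)
  bdd_inv : BddAbove ((fun x => deriv φ x / A x ^ 2) '' openI a b)

/-- The inverse of `φ : (a, b) → (a, b)`. -/
def phiInv (a b : EReal) (φ : ℝ → ℝ) : ℝ → ℝ := Function.invFunOn φ (openI a b)

/-- The functional equations, for a.e. `x ∈ (a, b)`:
`r = C r ∘ φ⁻¹`, `p = (A ∘ φ⁻¹)² (φ' ∘ φ⁻¹) (p ∘ φ⁻¹)`, and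
`q = ((A / φ') ∘ φ⁻¹) ((A q - (A^{[1]})') ∘ φ⁻¹)`. -/
structure FunctionalEquations (a b : EReal) (p q r A A₁ φ : ℝ → ℝ) (C : ℝ) : Prop where
  eq_r : ∀ᵐ x ∂(volume.restrict (openI a b)), r x = C * r (phiInv a b φ x)
  eq_p : ∀ᵐ x ∂(volume.restrict (openI a b)),
    p x = A (phiInv a b φ x) ^ 2 * deriv φ (phiInv a b φ x) * p (phiInv a b φ x)
  eq_q : ∀ᵐ x ∂(volume.restrict (openI a b)),
    q x = A (phiInv a b φ x) / deriv φ (phiInv a b φ x) *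
      (A (phiInv a b φ x) * q (phiInv a b φ x) - deriv A₁ (phiInv a b φ x))

end SturmLiouville

end

/-!
Let `K f = A · (f ∘ φ)` and `J f = (C φ' / A) · (f ∘ φ)`; by the change of variables `u = φ x` and
`r ∘ φ = C r` these are bounded and `K* J = 1`. The functional equations for `p` and `q` say that
`τ f = g` implies `τ (K f) = J g`, which is seen by writing `τ f = g` as the first-order system for
`(f, f^{[1]})`. So `K × J` maps the graphs of `T_max` and `T_{min,0}` into themselves, hence also
the closure of the latter. The hypotheses are invariant under `(A, φ, C) ↦ (1 / (A ∘ φ⁻¹), φ⁻¹,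
1 / C)`, a substitution that turns `K` into `K⁻¹`, so `K⁻¹ × J⁻¹` maps these graphs into themselves
too, and `K* T K = T` follows.

If `g` is orthogonal to `D(T_{min,0})`, solve `τ y = g` on a short interval `[c, d]` and correct `y`
by solutions of the homogeneous equation so that it becomes orthogonal to them. Then `y` (extended
by zero) is itself of the form `T_{min,0} f`, and the Lagrange identity gives
`‖y‖² = ⟨y, τ f⟩ = ⟨g, f⟩ = 0`, so that `g = 0` on `(c, d)`. Hence `T_{min,0}` is densely defined;
its adjoint extends `T_max` by the Lagrange identity, and `T_max` is closable.
-/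

noncomputable section

namespace SturmLiouville

open scoped NNReal InnerProductSpace

section AbsoluteContinuity

variable {E F X Y : Type*} [PseudoMetricSpace X] [PseudoMetricSpace Y]
  [NormedAddCommGroup E] [NormedAddCommGroup F] {s t : Set ℝ} {c d : ℝ}

lemma absolutelyContinuousOnInterval_of_dist_le {f : ℝ → X} {g : ℝ → Y} (K : ℝ)
    (hg : AbsolutelyContinuousOnInterval g c d)
    (h : ∀ x ∈ uIcc c d, ∀ y ∈ uIcc c d, dist (f x) (f y) ≤ K * dist (g x) (g y)) :
    AbsolutelyContinuousOnInterval f c d := by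
  refine squeeze_zero' (Eventually.of_forall fun _ ↦ Finset.sum_nonneg fun _ _ ↦ dist_nonneg)
    (eventually_inf_principal.2 (Eventually.of_forall fun I hI ↦ ?_))
    (by simpa only [mul_zero] using Tendsto.const_mul K hg)
  rw [Finset.mul_sum]
  exact Finset.sum_le_sum fun i hi ↦ h _ (hI.1 i hi).1 _ (hI.1 i hi).2

lemma absolutelyContinuousOnInterval_clm_comp [NormedSpace ℝ E] [NormedSpace ℝ F] {f : ℝ → E}
    (L : E →L[ℝ] F) (hf : AbsolutelyContinuousOnInterval f c d) :
    AbsolutelyContinuousOnInterval (fun x ↦ L (f x)) c d :=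
  absolutelyContinuousOnInterval_of_dist_le ‖L‖ hf
    fun x _ y _ ↦ by simpa only [dist_eq_norm, map_sub] using L.le_opNorm (f x - f y)

lemma disjoint_uIoc_map_of_monotoneOn {φ : ℝ → ℝ} (hφ : MonotoneOn φ s) {u v x y : ℝ}
    (hu : u ∈ s) (hv : v ∈ s) (hx : x ∈ s) (hy : y ∈ s) (h : Disjoint (uIoc u v) (uIoc x y)) :
    Disjoint (uIoc (φ u) (φ v)) (uIoc (φ x) (φ y)) := by
  have hmin {x y : ℝ} (hx : x ∈ s) (hy : y ∈ s) : min x y ∈ s := by grind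
  have hmax {x y : ℝ} (hx : x ∈ s) (hy : y ∈ s) : max x y ∈ s := by grind
  rw [uIoc, uIoc, Ioc_disjoint_Ioc] at h ⊢
  rw [← hφ.map_max hu hv, ← hφ.map_max hx hy, ← hφ.map_min hu hv, ← hφ.map_min hx hy,
    ← hφ.map_min (hmax hu hv) (hmax hx hy), ← hφ.map_max (hmin hu hv) (hmin hx hy)]
  exact hφ (hmin (hmax hu hv) (hmax hx hy)) (hmax (hmin hu hv) (hmin hx hy)) h

lemma absolutelyContinuousOnInterval_comp_of_monotoneOn {f : ℝ → X} {φ : ℝ → ℝ}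
    (hf : AbsolutelyContinuousOnInterval f (φ c) (φ d)) (hmono : MonotoneOn φ (uIcc c d))
    (hφ : AbsolutelyContinuousOnInterval φ c d) :
    AbsolutelyContinuousOnInterval (fun x ↦ f (φ x)) c d := by
  rw [absolutelyContinuousOnInterval_iff] at hf hφ ⊢
  intro ε hε
  obtain ⟨δ, hδ, hfδ⟩ := hf ε hε
  obtain ⟨η, hη, hφη⟩ := hφ δ hδ
  refine ⟨η, hη, fun I hI hlen ↦ hfδ (I.1, fun i ↦ (φ (I.2 i).1, φ (I.2 i).2)) ⟨?_, ?_⟩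
    (hφη I hI hlen)⟩
  · exact fun i hi ↦ ⟨hmono.mapsTo_uIcc (hI.1 i hi).1, hmono.mapsTo_uIcc (hI.1 i hi).2⟩
  · exact fun i hi j hj hij ↦ disjoint_uIoc_map_of_monotoneOn hmono (hI.1 i hi).1 (hI.1 i hi).2
      (hI.1 j hj).1 (hI.1 j hj).2 (hI.2 hi hj hij)

namespace ACLoc

lemma mono {f : ℝ → E} (hf : ACLoc t f) (hst : s ⊆ t) : ACLoc s f :=
  fun c hc d hd ↦ hf c (hst hc) d (hst hd)

lemma const (k : E) : ACLoc s (fun _ ↦ k) :=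
  fun _ _ _ _ ↦ (LipschitzWith.const k).lipschitzOnWith.absolutelyContinuousOnInterval

lemma add {f g : ℝ → E} (hf : ACLoc s f) (hg : ACLoc s g) : ACLoc s (fun x ↦ f x + g x) :=
  fun c hc d hd ↦ (hf c hc d hd).fun_add (hg c hc d hd)

lemma sub {f g : ℝ → E} (hf : ACLoc s f) (hg : ACLoc s g) : ACLoc s (fun x ↦ f x - g x) :=
  fun c hc d hd ↦ (hf c hc d hd).fun_sub (hg c hc d hd)

lemma smul {𝕜 : Type*} [NormedField 𝕜] [NormedSpace 𝕜 E] {f : ℝ → 𝕜} {g : ℝ → E}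
    (hf : ACLoc s f) (hg : ACLoc s g) : ACLoc s (fun x ↦ f x • g x) :=
  fun c hc d hd ↦ (hf c hc d hd).fun_smul (hg c hc d hd)

lemma clm_comp [NormedSpace ℝ E] [NormedSpace ℝ F] {f : ℝ → E} (L : E →L[ℝ] F)
    (hf : ACLoc s f) : ACLoc s (fun x ↦ L (f x)) :=
  fun c hc d hd ↦ absolutelyContinuousOnInterval_clm_comp L (hf c hc d hd)

lemma inv [s.OrdConnected] {f : ℝ → ℝ} (hf : ACLoc s f) (h0 : ∀ x ∈ s, f x ≠ 0) :
    ACLoc s (fun x ↦ (f x)⁻¹) := by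
  intro c hc d hd
  have hsub : uIcc c d ⊆ s := OrdConnected.uIcc_subset ‹_› hc hd
  obtain ⟨M, hM⟩ := isCompact_uIcc.exists_bound_of_continuousOn
    ((hf c hc d hd).continuousOn.inv₀ fun x hx ↦ h0 x (hsub hx))
  refine absolutelyContinuousOnInterval_of_dist_le (M * M) (hf c hc d hd) fun x hx y hy ↦ ?_
  rw [dist_inv_inv₀ (h0 x (hsub hx)) (h0 y (hsub hy)), div_eq_inv_mul, mul_inv, ← norm_inv,
    ← norm_inv]
  gcongr
  exacts [(norm_nonneg _).trans (hM x hx), hM x hx, hM y hy]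

lemma comp_monotoneOn {f : ℝ → E} {φ : ℝ → ℝ} [s.OrdConnected] (hf : ACLoc t f)
    (hφ : ACLoc s φ) (hmono : MonotoneOn φ s) (hmaps : MapsTo φ s t) :
    ACLoc s (fun x ↦ f (φ x)) :=
  fun c hc d hd ↦ absolutelyContinuousOnInterval_comp_of_monotoneOn
    (hf _ (hmaps hc) _ (hmaps hd)) (hmono.mono (OrdConnected.uIcc_subset ‹_› hc hd))
    (hφ c hc d hd)

lemma continuousOn_of_isOpen {f : ℝ → E} (hs : IsOpen s) (hf : ACLoc s f) :
    ContinuousOn f s := by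
  intro x hx
  obtain ⟨ε, hε, hball⟩ := Metric.nhds_basis_closedBall.mem_iff.1 (hs.mem_nhds hx)
  rw [Real.closedBall_eq_Icc] at hball
  have hle : x - ε ≤ x + ε := by linarith
  have hf' := (hf _ (hball (left_mem_Icc.2 hle)) _ (hball (right_mem_Icc.2 hle))).continuousOn
  rw [uIcc_of_le hle] at hf'
  exact (hf'.continuousAt (Icc_mem_nhds (by linarith) (by linarith))).continuousWithinAt

lemma ae_differentiableAt_of_finiteDimensional [NormedSpace ℝ E] [FiniteDimensional ℝ E]
    {a b : EReal} {f : ℝ → E} (hf : ACLoc (openI a b) f) :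
    ∀ᵐ x ∂(volume.restrict (openI a b)), DifferentiableAt ℝ f x :=
  ae_restrict_openI_of_rat fun c hc d hd ↦
    (hf c hc d hd).boundedVariationOn.ae_differentiableAt_of_mem_uIcc

lemma intervalIntegral_of_integrable [NormedSpace ℝ E] {f : ℝ → E} (hf : Integrable f) (e : ℝ) :
    ACLoc univ (fun x ↦ ∫ t in e..x, f t) := by
  intro c _ d _
  have hnorm : AbsolutelyContinuousOnInterval (fun x ↦ ∫ t in c..x, ‖f t‖) c d :=
    hf.norm.intervalIntegrable.absolutelyContinuousOnInterval_intervalIntegral left_mem_uIcc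
  refine absolutelyContinuousOnInterval_of_dist_le 1 hnorm fun x _ y _ ↦ ?_
  rw [one_mul, dist_comm, dist_comm (∫ t in c..x, ‖f t‖), dist_eq_norm, dist_eq_norm,
    intervalIntegral.integral_interval_sub_left hf.intervalIntegrable hf.intervalIntegrable,
    intervalIntegral.integral_interval_sub_left hf.norm.intervalIntegrable
      hf.norm.intervalIntegrable]
  exact intervalIntegral.norm_integral_le_abs_integral_norm

end ACLoc

variable [NormedSpace ℝ E] [FiniteDimensional ℝ E]

lemma intervalIntegrable_of_forall_dual {f : ℝ → E}
    (h : ∀ L : E →L[ℝ] ℝ, IntervalIntegrable (fun x ↦ L (f x)) volume c d) :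
    IntervalIntegrable f volume c d := by
  let b := Module.finBasis ℝ E
  have hsum : f = fun x ↦ ∑ i, (b.coord i).toContinuousLinearMap (f x) • b i :=
    funext fun x ↦ (b.sum_repr (f x)).symm
  rw [hsum, intervalIntegrable_iff]
  exact integrable_finsetSum _ fun i _ ↦ (intervalIntegrable_iff.1 (h _)).smul_const (b i)

lemma intervalIntegral_eq_sub_of_absolutelyContinuous {f f' : ℝ → E}
    (hf : AbsolutelyContinuousOnInterval f c d)
    (hderiv : ∀ᵐ x, x ∈ uIcc c d → HasDerivAt f (f' x) x) :
    IntervalIntegrable f' volume c d ∧ ∫ x in c..d, f' x = f d - f c := by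
  have hac (L : E →L[ℝ] ℝ) : AbsolutelyContinuousOnInterval (fun x ↦ L (f x)) c d :=
    absolutelyContinuousOnInterval_clm_comp L hf
  have hL (L : E →L[ℝ] ℝ) : ∀ᵐ x, x ∈ uIoc c d → deriv (fun x ↦ L (f x)) x = L (f' x) := by
    filter_upwards [hderiv] with x hx hxm
    exact (L.hasFDerivAt.comp_hasDerivAt x (hx (uIoc_subset_uIcc hxm))).deriv
  have hint : IntervalIntegrable f' volume c d := intervalIntegrable_of_forall_dual fun L ↦
    (hac L).intervalIntegrable_deriv.congr_ae ((ae_restrict_iff' measurableSet_uIoc).2 (hL L))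
  refine ⟨hint, SeparatingDual.eq_iff_forall_dual_eq (R := ℝ) |>.2 fun L ↦ ?_⟩
  rw [← L.intervalIntegral_comp_comm hint, ← intervalIntegral.integral_congr_ae (hL L),
    (hac L).integral_deriv_eq_sub, map_sub]

end AbsoluteContinuity

section Caratheodory

open BoundedContinuousFunction

variable {E : Type*} [NormedAddCommGroup E] [NormedSpace ℝ E] {M : ℝ → E →L[ℝ] E} {W : ℝ → E}

lemma norm_intervalIntegral_le_integral_norm {f : ℝ → E} (hf : Integrable f) (c x : ℝ) :
    ‖∫ t in c..x, f t‖ ≤ ∫ t, ‖f t‖ :=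
  intervalIntegral.norm_integral_le_integral_norm_uIoc.trans
    (setIntegral_le_integral hf.norm (Eventually.of_forall fun _ ↦ norm_nonneg _))

lemma integrable_clm_apply_boundedContinuousFunction (hM : Integrable M) (u : ℝ →ᵇ E) :
    Integrable (fun t ↦ M t (u t)) :=
  (hM.norm.mul_const ‖u‖).mono'
    ((ContinuousLinearMap.id ℝ (E →L[ℝ] E)).aestronglyMeasurable_comp₂ hM.aestronglyMeasurable
      u.continuous.aestronglyMeasurable)
    (Eventually.of_forall fun t ↦ (M t).le_opNorm_of_le (u.norm_coe_le_norm t))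

lemma integrable_clm_apply_add (hM : Integrable M) (hW : Integrable W) (u : ℝ →ᵇ E) :
    Integrable (fun t ↦ M t (u t) + W t) :=
  (integrable_clm_apply_boundedContinuousFunction hM u).add hW

/-- The Picard map `u ↦ η + ∫ₑˣ (M u + W)` of the initial value problem `Y' = M Y + W`, `Y e = η`,
on the Banach space of bounded continuous functions. -/
def picardMap (hM : Integrable M) (hW : Integrable W) (e : ℝ) (η : E) (u : ℝ →ᵇ E) : ℝ →ᵇ E :=
  ofNormedAddCommGroup (fun x ↦ η + ∫ t in e..x, (M t (u t) + W t))
    (continuous_const.add (intervalIntegral.continuous_primitive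
      (fun _ _ ↦ (integrable_clm_apply_add hM hW u).intervalIntegrable) e))
    (‖η‖ + ∫ t, ‖M t (u t) + W t‖)
    fun x ↦ (norm_add_le _ _).trans <| add_le_add_right
      (norm_intervalIntegral_le_integral_norm (integrable_clm_apply_add hM hW u) e x) _

lemma picardMap_apply (hM : Integrable M) (hW : Integrable W) (e : ℝ) (η : E) (u : ℝ →ᵇ E)
    (x : ℝ) : picardMap hM hW e η u x = η + ∫ t in e..x, (M t (u t) + W t) := rfl

lemma contractingWith_picardMap (hM : Integrable M) (hW : Integrable W) (e : ℝ) (η : E)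
    {k : ℝ≥0} (hk : k < 1) (hMk : ∫ t, ‖M t‖ ≤ k) : ContractingWith k (picardMap hM hW e η) := by
  refine ⟨hk, LipschitzWith.of_dist_le_mul fun u v ↦ (dist_le (by positivity)).2 fun x ↦ ?_⟩
  have hint := integrable_clm_apply_boundedContinuousFunction hM (u - v)
  calc dist (picardMap hM hW e η u x) (picardMap hM hW e η v x)
      = ‖∫ t in e..x, M t ((u - v) t)‖ := by
        rw [picardMap_apply, picardMap_apply, dist_add_left, dist_eq_norm,
          ← intervalIntegral.integral_sub (integrable_clm_apply_add hM hW u).intervalIntegrable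
            (integrable_clm_apply_add hM hW v).intervalIntegrable]
        simp only [add_sub_add_right_eq_sub, ← map_sub, coe_sub, Pi.sub_apply]
    _ ≤ ∫ t, ‖M t‖ * ‖u - v‖ := (norm_intervalIntegral_le_integral_norm hint e x).trans <|
        integral_mono hint.norm (hM.norm.mul_const _)
          fun t ↦ (M t).le_opNorm_of_le ((u - v).norm_coe_le_norm t)
    _ ≤ k * dist u v := by
        rw [integral_mul_const, dist_eq_norm]
        gcongr

lemma exists_caratheodory_solution [CompleteSpace E] (hM : Integrable M) (hW : Integrable W)
    (hM1 : ∫ t, ‖M t‖ < 1) (e : ℝ) (η : E) :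
    ∃ Y : ℝ → E, Y e = η ∧ ACLoc univ Y ∧ ∀ᵐ x, HasDerivAt Y (M x (Y x) + W x) x := by
  have hcontr := contractingWith_picardMap hM hW e η
    (k := ⟨∫ t, ‖M t‖, integral_nonneg fun t ↦ norm_nonneg _⟩) hM1 le_rfl
  let Y := hcontr.fixedPoint (picardMap hM hW e η)
  have hY (x : ℝ) : Y x = η + ∫ t in e..x, (M t (Y t) + W t) := by
    rw [← picardMap_apply hM hW, hcontr.fixedPoint_isFixedPt.eq]
  have hint := integrable_clm_apply_add hM hW Y
  refine ⟨Y, by rw [hY, intervalIntegral.integral_same, add_zero], ?_, ?_⟩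
  · rw [funext hY]
    exact (ACLoc.const η).add (ACLoc.intervalIntegral_of_integrable hint e)
  · filter_upwards [LocallyIntegrable.ae_hasDerivAt_integral hint.locallyIntegrable] with x hx
    exact ((hx e).const_add η).congr_of_eventuallyEq (Eventually.of_forall hY)

end Caratheodory

section FirstOrderSystem

open ComplexConjugate

/-- `(y, y₁)` is a Carathéodory solution on `s` of the first-order system `y' = P y₁`,
`y₁' = Q y - w`. With `P = 1 / p`, `Q = q`, `w = r g` and `y₁ = y^{[1]}` this is `τ y = g`. -/
structure IsSystemSolution (s : Set ℝ) (P Q : ℝ → ℝ) (w y y₁ : ℝ → ℂ) : Prop where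
  acLoc : ACLoc s y
  acLoc₁ : ACLoc s y₁
  hasDerivAt : ∀ᵐ x, x ∈ s → HasDerivAt y (P x * y₁ x) x
  hasDerivAt₁ : ∀ᵐ x, x ∈ s → HasDerivAt y₁ (Q x * y x - w x) x

lemma eq_zero_of_hasDerivAt_of_eqOn_zero {f : ℝ → ℂ} {f' : ℂ} {x : ℝ} {U : Set ℝ}
    (h : HasDerivAt f f' x) (hU : IsOpen U) (hx : x ∈ U) (hf : EqOn f 0 U) : f' = 0 :=
  (h.congr_of_eventuallyEq (hf.eventuallyEq_of_mem (hU.mem_nhds hx)).symm).unique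
    (hasDerivAt_const x 0)

namespace IsSystemSolution

variable {s t U : Set ℝ} {P Q : ℝ → ℝ} {w v y y₁ z z₁ : ℝ → ℂ} {c d : ℝ}

lemma mono (hy : IsSystemSolution t P Q w y y₁) (hst : s ⊆ t) : IsSystemSolution s P Q w y y₁ where
  acLoc := hy.acLoc.mono hst
  acLoc₁ := hy.acLoc₁.mono hst
  hasDerivAt := hy.hasDerivAt.mono fun _ h hx ↦ h (hst hx)
  hasDerivAt₁ := hy.hasDerivAt₁.mono fun _ h hx ↦ h (hst hx)

lemma congr_ae (hy : IsSystemSolution s P Q w y y₁) (hwv : ∀ᵐ x, x ∈ s → w x = v x) :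
    IsSystemSolution s P Q v y y₁ where
  acLoc := hy.acLoc
  acLoc₁ := hy.acLoc₁
  hasDerivAt := hy.hasDerivAt
  hasDerivAt₁ := by
    filter_upwards [hy.hasDerivAt₁, hwv] with x hyx hwx hx
    exact hwx hx ▸ hyx hx

lemma sub_const_mul (hy : IsSystemSolution s P Q w y y₁) (hz : IsSystemSolution s P Q v z z₁)
    (k : ℂ) : IsSystemSolution s P Q (fun x ↦ w x - k * v x) (fun x ↦ y x - k * z x)
      (fun x ↦ y₁ x - k * z₁ x) where
  acLoc := hy.acLoc.sub ((ACLoc.const k).smul hz.acLoc)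
  acLoc₁ := hy.acLoc₁.sub ((ACLoc.const k).smul hz.acLoc₁)
  hasDerivAt := by
    filter_upwards [hy.hasDerivAt, hz.hasDerivAt] with x hyx hzx hx
    convert! (hyx hx).sub ((hzx hx).const_mul k) using 1
    ring
  hasDerivAt₁ := by
    filter_upwards [hy.hasDerivAt₁, hz.hasDerivAt₁] with x hyx hzx hx
    convert! (hyx hx).sub ((hzx hx).const_mul k) using 1
    ring

theorem lagrange_identity [s.OrdConnected] (hy : IsSystemSolution s P Q w y y₁)
    (hz : IsSystemSolution s P Q v z z₁) (hc : c ∈ s) (hd : d ∈ s) :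
    ∫ x in c..d, (w x * conj (z x) - y x * conj (v x)) =
      (y d * conj (z₁ d) - y₁ d * conj (z d)) - (y c * conj (z₁ c) - y₁ c * conj (z c)) := by
  have hconj {u : ℝ → ℂ} (hu : ACLoc s u) : ACLoc s (fun x ↦ conj (u x)) :=
    hu.clm_comp Complex.conjCLE.toContinuousLinearMap
  have hbracket : ACLoc s (fun x ↦ y x * conj (z₁ x) - y₁ x * conj (z x)) :=
    (hy.acLoc.smul (hconj hz.acLoc₁)).sub (hy.acLoc₁.smul (hconj hz.acLoc))
  refine (intervalIntegral_eq_sub_of_absolutelyContinuous (hbracket c hc d hd) ?_).2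
  filter_upwards [hy.hasDerivAt, hy.hasDerivAt₁, hz.hasDerivAt, hz.hasDerivAt₁]
    with x hyx hyx₁ hzx hzx₁ hx
  have hxs : x ∈ s := OrdConnected.uIcc_subset ‹_› hc hd hx
  convert! ((hyx hxs).mul (hzx₁ hxs).star).sub ((hyx₁ hxs).mul (hzx hxs).star) using 1
  simp only [RCLike.star_def, map_sub, map_mul, Complex.conj_ofReal]
  ring

lemma eq_zero_of_ae_eq_zero (hy : IsSystemSolution s P Q w y y₁) (hU : IsOpen U) (hUs : U ⊆ s)
    (hP : ∀ᵐ x, x ∈ U → P x ≠ 0) (hy0 : ∀ᵐ x, x ∈ U → y x = 0) :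
    EqOn y 0 U ∧ EqOn y₁ 0 U ∧ ∀ᵐ x, x ∈ U → w x = 0 := by
  have eqOn_zero {u : ℝ → ℂ} (hu : ACLoc s u) (hu0 : ∀ᵐ x, x ∈ U → u x = 0) : EqOn u 0 U :=
    Measure.eqOn_open_of_ae_eq ((ae_restrict_iff' hU.measurableSet).2 hu0) hU
      ((hu.mono hUs).continuousOn_of_isOpen hU) continuousOn_const
  have hyU : EqOn y 0 U := eqOn_zero hy.acLoc hy0
  have hy₁U : EqOn y₁ 0 U := eqOn_zero hy.acLoc₁ <| by
    filter_upwards [hy.hasDerivAt, hP] with x hyx hPx hx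
    simpa [hPx hx] using eq_zero_of_hasDerivAt_of_eqOn_zero (hyx (hUs hx)) hU hx hyU
  refine ⟨hyU, hy₁U, ?_⟩
  filter_upwards [hy.hasDerivAt₁] with x hyx₁ hx
  simpa [hyU hx] using eq_zero_of_hasDerivAt_of_eqOn_zero (hyx₁ (hUs hx)) hU hx hy₁U

lemma eq_of_coefficients_eq_zero [s.OrdConnected] (hy : IsSystemSolution s P Q w y y₁)
    (hc : c ∈ s) (hd : d ∈ s) (hP : ∀ x ∈ uIoo c d, P x = 0) (hQ : ∀ x ∈ uIoo c d, Q x = 0)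
    (hw : ∀ x ∈ uIoo c d, w x = 0) : y d = y c ∧ y₁ d = y₁ c := by
  have hsub : uIcc c d ⊆ s := OrdConnected.uIcc_subset ‹_› hc hd
  constructor <;> rw [← sub_eq_zero]
  · rw [← (intervalIntegral_eq_sub_of_absolutelyContinuous (hy.acLoc c hc d hd)
      (hy.hasDerivAt.mono fun x h hx ↦ h (hsub hx))).2,
      intervalIntegral.integral_congr_uIoo (g := fun _ ↦ 0) fun x hx ↦ by simp [hP x hx],
      intervalIntegral.integral_zero]
  · rw [← (intervalIntegral_eq_sub_of_absolutelyContinuous (hy.acLoc₁ c hc d hd)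
      (hy.hasDerivAt₁.mono fun x h hx ↦ h (hsub hx))).2,
      intervalIntegral.integral_congr_uIoo (g := fun _ ↦ 0) fun x hx ↦ by simp [hQ x hx, hw x hx],
      intervalIntegral.integral_zero]

end IsSystemSolution

/-- The matrix `[[0, P], [Q, 0]]` of the first-order system, acting on pairs `(y, y₁)`. -/
def systemMatrix (P Q : ℝ) : ℂ × ℂ →L[ℝ] ℂ × ℂ :=
  P • (ContinuousLinearMap.inl ℝ ℂ ℂ ∘L ContinuousLinearMap.snd ℝ ℂ ℂ) +
    Q • (ContinuousLinearMap.inr ℝ ℂ ℂ ∘L ContinuousLinearMap.fst ℝ ℂ ℂ)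

lemma systemMatrix_apply (P Q : ℝ) (η : ℂ × ℂ) : systemMatrix P Q η = (P * η.2, Q * η.1) := by
  simp [systemMatrix]

lemma norm_systemMatrix_le (P Q : ℝ) : ‖systemMatrix P Q‖ ≤ ‖P‖ + ‖Q‖ := by
  refine ContinuousLinearMap.opNorm_le_bound _ (by positivity) fun η ↦ ?_
  rw [systemMatrix_apply, Prod.norm_def, norm_mul, norm_mul, Complex.norm_real, Complex.norm_real]
  refine max_le ?_ ?_
  · gcongr
    exacts [le_add_of_nonneg_right (norm_nonneg Q), norm_snd_le η]
  · gcongr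
    exacts [le_add_of_nonneg_left (norm_nonneg P), norm_fst_le η]

theorem exists_isSystemSolution {P Q : ℝ → ℝ} {w : ℝ → ℂ} (hP : Integrable P) (hQ : Integrable Q)
    (hw : Integrable w) (hPQ : ∫ x, (‖P x‖ + ‖Q x‖) < 1) (e : ℝ) (α β : ℂ) :
    ∃ y y₁ : ℝ → ℂ, y e = α ∧ y₁ e = β ∧ IsSystemSolution univ P Q w y y₁ := by
  have hM : Integrable (fun x ↦ systemMatrix (P x) (Q x)) :=
    (hP.smul_const (ContinuousLinearMap.inl ℝ ℂ ℂ ∘L ContinuousLinearMap.snd ℝ ℂ ℂ)).add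
      (hQ.smul_const (ContinuousLinearMap.inr ℝ ℂ ℂ ∘L ContinuousLinearMap.fst ℝ ℂ ℂ))
  have hW : Integrable (fun x ↦ ((0 : ℂ), -w x)) := (integrable_zero _ _ _).prodMk hw.neg
  obtain ⟨Y, hYe, hY, hYd⟩ := exists_caratheodory_solution hM hW
    ((integral_mono hM.norm (hP.norm.add hQ.norm) fun x ↦ norm_systemMatrix_le _ _).trans_lt hPQ)
    e (α, β)
  refine ⟨fun x ↦ (Y x).1, fun x ↦ (Y x).2, congrArg Prod.fst hYe, congrArg Prod.snd hYe,
    hY.clm_comp (.fst ℝ ℂ ℂ), hY.clm_comp (.snd ℝ ℂ ℂ), ?_, ?_⟩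
  · filter_upwards [hYd] with x hx _
    refine ((ContinuousLinearMap.fst ℝ ℂ ℂ).hasFDerivAt.comp_hasDerivAt x hx).congr_deriv ?_
    simp [systemMatrix_apply]
  · filter_upwards [hYd] with x hx _
    refine ((ContinuousLinearMap.snd ℝ ℂ ℂ).hasFDerivAt.comp_hasDerivAt x hx).congr_deriv ?_
    simp [systemMatrix_apply, sub_eq_add_neg]

/-- `(y, y₁)` solves, on the whole line, the system whose coefficients are cut off outside
`[c, d]`. It solves the original system on `[c, d]` and is constant to the left and to the right
of `[c, d]`. -/
abbrev IsTruncatedSolution (c d : ℝ) (P Q : ℝ → ℝ) (w y y₁ : ℝ → ℂ) : Prop :=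
  IsSystemSolution univ ((Icc c d).indicator P) ((Icc c d).indicator Q) ((Icc c d).indicator w) y y₁

lemma exists_isTruncatedSolution {c d : ℝ} {P Q : ℝ → ℝ} {w : ℝ → ℂ}
    (hP : IntegrableOn P (Icc c d)) (hQ : IntegrableOn Q (Icc c d))
    (hw : IntegrableOn w (Icc c d)) (hPQ : ∫ x in Icc c d, (‖P x‖ + ‖Q x‖) < 1)
    (e : ℝ) (α β : ℂ) :
    ∃ y y₁ : ℝ → ℂ, y e = α ∧ y₁ e = β ∧ IsTruncatedSolution c d P Q w y y₁ := by
  refine exists_isSystemSolution (hP.integrable_indicator measurableSet_Icc)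
    (hQ.integrable_indicator measurableSet_Icc) (hw.integrable_indicator measurableSet_Icc) ?_ e α β
  simpa only [← integral_indicator measurableSet_Icc, indicator_add,
    norm_indicator_eq_indicator_norm] using hPQ

namespace IsTruncatedSolution

variable {c d : ℝ} {P Q : ℝ → ℝ} {w y y₁ : ℝ → ℂ}

lemma isSystemSolution_Icc (hy : IsTruncatedSolution c d P Q w y y₁) :
    IsSystemSolution (Icc c d) P Q w y y₁ where
  acLoc := hy.acLoc.mono (subset_univ _)
  acLoc₁ := hy.acLoc₁.mono (subset_univ _)
  hasDerivAt := by
    filter_upwards [hy.hasDerivAt] with x h hx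
    simpa only [indicator_of_mem hx] using h trivial
  hasDerivAt₁ := by
    filter_upwards [hy.hasDerivAt₁] with x h hx
    simpa only [indicator_of_mem hx] using h trivial

lemma eq_zero_of_notMem (hy : IsTruncatedSolution c d P Q w y y₁) (hc : y c = 0 ∧ y₁ c = 0)
    (hd : y d = 0 ∧ y₁ d = 0) {x : ℝ} (hx : x ∉ Icc c d) : y x = 0 ∧ y₁ x = 0 := by
  have eq_endpoint {e : ℝ} (he : ∀ u ∈ uIoo e x, u ∉ Icc c d) : y x = y e ∧ y₁ x = y₁ e :=
    hy.eq_of_coefficients_eq_zero (mem_univ e) (mem_univ x)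
      (fun u hu ↦ indicator_of_notMem (he u hu) P) (fun u hu ↦ indicator_of_notMem (he u hu) Q)
      fun u hu ↦ indicator_of_notMem (he u hu) w
  rcases lt_or_ge x c with hxc | hcx
  · have hyc := eq_endpoint (e := c) fun u hu huI ↦ by
      rw [uIoo_of_gt hxc] at hu
      exact hu.2.not_ge huI.1
    rwa [hc.1, hc.2] at hyc
  · have hdx : d < x := not_le.1 fun h ↦ hx ⟨hcx, h⟩
    have hyd := eq_endpoint (e := d) fun u hu huI ↦ by
      rw [uIoo_of_lt hdx] at hu
      exact hu.1.not_ge huI.2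
    rwa [hd.1, hd.2] at hyd

lemma isSystemSolution_univ (hy : IsTruncatedSolution c d P Q w y y₁)
    (hc : y c = 0 ∧ y₁ c = 0) (hd : y d = 0 ∧ y₁ d = 0) :
    IsSystemSolution univ P Q ((Icc c d).indicator w) y y₁ where
  acLoc := hy.acLoc
  acLoc₁ := hy.acLoc₁
  hasDerivAt := by
    filter_upwards [hy.hasDerivAt] with x h _
    by_cases hx : x ∈ Icc c d
    · simpa only [indicator_of_mem hx] using h trivial
    · simpa [hy.eq_zero_of_notMem hc hd hx] using h trivial
  hasDerivAt₁ := by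
    filter_upwards [hy.hasDerivAt₁] with x h _
    by_cases hx : x ∈ Icc c d
    · simpa only [indicator_of_mem hx] using h trivial
    · simpa [hy.eq_zero_of_notMem hc hd hx] using h trivial

end IsTruncatedSolution

end FirstOrderSystem

section Operators

open ComplexConjugate

variable {a b : EReal} {p q r : ℝ → ℝ} {c d : ℝ}

lemma ae_restrict_openI_iff {S : ℝ → Prop} :
    (∀ᵐ x ∂(volume.restrict (openI a b)), S x) ↔ ∀ᵐ x, x ∈ openI a b → S x :=
  ae_restrict_iff' (isOpen_openI a b).measurableSet

lemma exists_Ioo_superset_of_isCompact (hab : a < b) {S : Set ℝ} (hS : IsCompact S)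
    (hSI : S ⊆ openI a b) : ∃ c ∈ openI a b, ∃ d ∈ openI a b, c ≤ d ∧ S ⊆ Ioo c d := by
  obtain ⟨x₀, hax₀, hx₀b⟩ := EReal.lt_iff_exists_real_btwn.1 hab
  have hSx₀ : insert x₀ S ⊆ openI a b := insert_subset ⟨hax₀, hx₀b⟩ hSI
  obtain ⟨m, hm, hmin⟩ := (hS.insert x₀).exists_isLeast (insert_nonempty _ _)
  obtain ⟨M, hM, hmax⟩ := (hS.insert x₀).exists_isGreatest (insert_nonempty _ _)
  obtain ⟨c, hac, hcm⟩ := EReal.lt_iff_exists_real_btwn.1 (hSx₀ hm).1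
  obtain ⟨d, hMd, hdb⟩ := EReal.lt_iff_exists_real_btwn.1 (hSx₀ hM).2
  have hcd : c ≤ d := by
    exact_mod_cast (hcm.le.trans (EReal.coe_le_coe_iff.2 (hmin hM))).trans hMd.le
  refine ⟨c, ⟨hac, hcm.trans (hSx₀ hm).2⟩, d, ⟨(hSx₀ hM).1.trans hMd, hdb⟩, hcd, fun x hx ↦ ?_⟩
  exact ⟨(EReal.coe_lt_coe_iff.1 hcm).trans_le (hmin (mem_insert_of_mem x₀ hx)),
    (hmax (mem_insert_of_mem x₀ hx)).trans_lt (EReal.coe_lt_coe_iff.1 hMd)⟩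

namespace IsCoefficients

lemma ae_weight (h : IsCoefficients a b p q r) :
    ae (weight a b r) = ae (volume.restrict (openI a b)) :=
  le_antisymm (withDensity_absolutelyContinuous _ _).ae_le
    (withDensity_absolutelyContinuous' h.aemeasurable_r.ennreal_ofReal
      (h.r_pos.mono fun x hx ↦ by simpa using hx)).ae_le

lemma ae_weight_iff (h : IsCoefficients a b p q r) {S : ℝ → Prop} :
    (∀ᵐ x ∂(weight a b r), S x) ↔ ∀ᵐ x, x ∈ openI a b → S x := by
  rw [h.ae_weight, ae_restrict_openI_iff]

lemma integral_weight (h : IsCoefficients a b p q r) (G : ℝ → ℂ) :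
    ∫ x, G x ∂(weight a b r) = ∫ x in openI a b, (r x : ℂ) * G x := by
  rw [weight, integral_withDensity_eq_integral_toReal_smul₀ h.aemeasurable_r.ennreal_ofReal
    (Eventually.of_forall fun _ ↦ ENNReal.ofReal_lt_top)]
  refine integral_congr_ae ?_
  filter_upwards [h.r_pos] with x hx
  rw [ENNReal.toReal_ofReal hx.le, Complex.real_smul]

lemma integral_weight_eq_intervalIntegral (h : IsCoefficients a b p q r) {G : ℝ → ℂ}
    (hcd : c ≤ d) (hI : Icc c d ⊆ openI a b) (hG : ∀ᵐ x ∂(weight a b r), x ∉ Icc c d → G x = 0) :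
    ∫ x, G x ∂(weight a b r) = ∫ x in c..d, (r x : ℂ) * G x := by
  rw [h.integral_weight, intervalIntegral.integral_of_le hcd, ← integral_Icc_eq_integral_Ioc]
  refine setIntegral_eq_of_subset_of_ae_sdiff_eq_zero
    (isOpen_openI a b).measurableSet.nullMeasurableSet hI ?_
  filter_upwards [h.ae_weight_iff.1 hG] with x hx hxI
  rw [hx hxI.1 hxI.2, mul_zero]

lemma weight_lt_top_of_isCompact (h : IsCoefficients a b p q r) {S : Set ℝ} (hS : IsCompact S)
    (hSI : S ⊆ openI a b) : weight a b r S < ∞ := by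
  rw [weight, withDensity_apply _ hS.measurableSet, Measure.restrict_restrict hS.measurableSet,
    inter_eq_self_of_subset_left hSI]
  exact (h.locInt_r.integrableOn_compact_subset hSI hS).lintegral_lt_top

lemma integrableOn_mul_of_isCompact (h : IsCoefficients a b p q r) {S : Set ℝ}
    (hS : IsCompact S) (hSI : S ⊆ openI a b) (g : L2 a b r) :
    IntegrableOn (fun x ↦ (r x : ℂ) * g x) S := by
  have : IsFiniteMeasure ((weight a b r).restrict S) :=
    ⟨by rw [Measure.restrict_apply_univ]; exact h.weight_lt_top_of_isCompact hS hSI⟩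
  have hrestrict : (weight a b r).restrict S =
      (volume.restrict S).withDensity (fun x ↦ ENNReal.ofReal (r x)) := by
    rw [weight, restrict_withDensity hS.measurableSet, Measure.restrict_restrict hS.measurableSet,
      inter_eq_self_of_subset_left hSI]
  have hg : Integrable g ((weight a b r).restrict S) :=
    ((Lp.memLp g).restrict S).integrable (by norm_num)
  rw [hrestrict] at hg
  have hr := ae_mono (Measure.restrict_mono hSI le_rfl) h.r_pos
  refine ((integrable_withDensity_iff_integrable_smul₀'
    (h.aemeasurable_r.mono_set hSI).ennreal_ofReal
    (Eventually.of_forall fun _ ↦ ENNReal.ofReal_lt_top)).1 hg).congr ?_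
  filter_upwards [hr] with x hx
  rw [ENNReal.toReal_ofReal hx.le, Complex.real_smul]

lemma exists_L2_eq_indicator (h : IsCoefficients a b p q r) {S : Set ℝ} (hS : IsCompact S)
    (hSI : S ⊆ openI a b) {u : ℝ → ℂ} (hu : ContinuousOn u S) :
    ∃ f : L2 a b r, f =ᵐ[weight a b r] S.indicator u := by
  obtain ⟨M, hM⟩ := hS.exists_bound_of_continuousOn hu
  have : IsFiniteMeasure ((weight a b r).restrict S) :=
    ⟨by rw [Measure.restrict_apply_univ]; exact h.weight_lt_top_of_isCompact hS hSI⟩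
  have hmem : MemLp (S.indicator u) 2 (weight a b r) :=
    (memLp_indicator_iff_restrict hS.measurableSet).2 <|
      MemLp.of_bound (hu.aestronglyMeasurable hS.measurableSet) M
        ((ae_restrict_iff' hS.measurableSet).2 (Eventually.of_forall hM))
  exact ⟨hmem.toLp _, hmem.coeFn_toLp⟩

lemma ae_one_div_p_ne_zero (h : IsCoefficients a b p q r) :
    ∀ᵐ x, x ∈ openI a b → 1 / p x ≠ 0 :=
  (ae_restrict_openI_iff.1 h.p_pos).mono fun _ hp hx ↦ (one_div_pos.2 (hp hx)).ne'

theorem tauRel_iff (h : IsCoefficients a b p q r) {f g : L2 a b r} :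
    TauRel a b p q r f g ↔ ∃ y y₁ : ℝ → ℂ, f =ᵐ[weight a b r] y ∧
      IsSystemSolution (openI a b) (fun x ↦ 1 / p x) q (fun x ↦ r x * g x) y y₁ := by
  have hp := ae_restrict_openI_iff.1 h.p_pos
  have hr := ae_restrict_openI_iff.1 h.r_pos
  constructor
  · rintro ⟨y, y₁, hfy, hy, hy₁, hquasi, hg⟩
    refine ⟨y, y₁, hfy, hy, hy₁, ?_, ?_⟩
    · filter_upwards [ae_restrict_openI_iff.1 hquasi, hp,
        ae_restrict_openI_iff.1 hy.ae_differentiableAt] with x hyx hpx hdiff hx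
      have : (p x : ℂ) ≠ 0 := mod_cast (hpx hx).ne'
      refine (hdiff hx).hasDerivAt.congr_deriv ?_
      rw [hyx hx, Complex.real_smul, Complex.ofReal_div, Complex.ofReal_one]
      field_simp
    · filter_upwards [h.ae_weight_iff.1 hg, hr,
        ae_restrict_openI_iff.1 hy₁.ae_differentiableAt] with x hgx hrx hdiff hx
      have : (r x : ℂ) ≠ 0 := mod_cast (hrx hx).ne'
      refine (hdiff hx).hasDerivAt.congr_deriv ?_
      rw [hgx hx, Complex.real_smul, Complex.real_smul, Complex.ofReal_div, Complex.ofReal_one]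
      field_simp
      ring
  · rintro ⟨y, y₁, hfy, hy⟩
    refine ⟨y, y₁, hfy, hy.acLoc, hy.acLoc₁, ae_restrict_openI_iff.2 ?_, h.ae_weight_iff.2 ?_⟩
    · filter_upwards [hy.hasDerivAt, hp] with x hyx hpx hx
      have : (p x : ℂ) ≠ 0 := mod_cast (hpx hx).ne'
      rw [(hyx hx).deriv, Complex.real_smul, Complex.ofReal_div, Complex.ofReal_one]
      field_simp
    · filter_upwards [hy.hasDerivAt₁, hr] with x hyx hrx hx
      have : (r x : ℂ) ≠ 0 := mod_cast (hrx hx).ne'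
      rw [(hyx hx).deriv, Complex.real_smul, Complex.real_smul, Complex.ofReal_div,
        Complex.ofReal_one]
      field_simp
      ring

theorem inner_sub_inner_eq_bracket (h : IsCoefficients a b p q r) (hcd : c ≤ d)
    (hI : Icc c d ⊆ openI a b) {f f' g g' : L2 a b r} {y y₁ z z₁ : ℝ → ℂ}
    (hf : f =ᵐ[weight a b r] (Icc c d).indicator y)
    (hf' : ∀ᵐ x ∂(weight a b r), x ∉ Icc c d → f' x = 0)
    (hg : ∀ᵐ x ∂(weight a b r), x ∈ Icc c d → g x = z x)
    (hy : IsSystemSolution (Icc c d) (fun x ↦ 1 / p x) q (fun x ↦ r x * f' x) y y₁)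
    (hz : IsSystemSolution (Icc c d) (fun x ↦ 1 / p x) q (fun x ↦ r x * g' x) z z₁) :
    ⟪g, f'⟫_ℂ - ⟪g', f⟫_ℂ =
      (y d * conj (z₁ d) - y₁ d * conj (z d)) - (y c * conj (z₁ c) - y₁ c * conj (z c)) := by
  have hinner (u v : L2 a b r) : ⟪u, v⟫_ℂ = ∫ x, v x * conj (u x) ∂(weight a b r) := rfl
  rw [hinner, hinner, ← integral_sub (L2.integrable_inner g f') (L2.integrable_inner g' f),
    h.integral_weight_eq_intervalIntegral hcd hI,
    ← hy.lagrange_identity hz (left_mem_Icc.2 hcd) (right_mem_Icc.2 hcd)]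
  · refine intervalIntegral.integral_congr_ae ?_
    filter_upwards [h.ae_weight_iff.1 hf, h.ae_weight_iff.1 hg] with x hfx hgx hx
    have hxI : x ∈ Icc c d := uIcc_of_le hcd ▸ uIoc_subset_uIcc hx
    rw [hfx (hI hxI), hgx (hI hxI) hxI, indicator_of_mem hxI, map_mul, Complex.conj_ofReal]
    ring
  · filter_upwards [hf, hf'] with x hfx hf'x hx
    rw [hfx, hf'x hx, indicator_of_notMem hx, zero_mul, zero_mul, sub_zero]

end IsCoefficients

lemma mem_graph_Tmin0 (h : IsCoefficients a b p q r) (f g : L2 a b r) :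
    (f, g) ∈ (Tmin0 a b p q r).graph ↔ TauRel a b p q r f g ∧ f ∈ compactlySupported a b r := by
  rw [← mem_graph_Tmax h]
  constructor
  · intro hfg
    exact ⟨LinearPMap.le_graph_of_le LinearPMap.domRestrict_le hfg,
      (LinearPMap.mem_domain_of_mem_graph hfg).1⟩
  · rintro ⟨hfg, hf⟩
    obtain ⟨y, rfl, rfl⟩ := (LinearPMap.mem_graph_iff _).1 hfg
    exact (LinearPMap.mem_graph_iff _).2 ⟨⟨y, hf, y.2⟩, rfl, LinearPMap.domRestrict_apply rfl⟩

theorem TauRel.inner_eq_of_compactlySupported (h : IsCoefficients a b p q r) {f f' g g' : L2 a b r}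
    (hf : TauRel a b p q r f f') (hfS : f ∈ compactlySupported a b r)
    (hg : TauRel a b p q r g g') : ⟪g, f'⟫_ℂ = ⟪g', f⟫_ℂ := by
  obtain ⟨y, y₁, hfy, hy⟩ := h.tauRel_iff.1 hf
  obtain ⟨z, z₁, hgz, hz⟩ := h.tauRel_iff.1 hg
  obtain ⟨S, hS, hSI, hfS⟩ := hfS
  obtain ⟨c, hc, d, hd, hcd, hScd⟩ := exists_Ioo_superset_of_isCompact h.lt hS hSI
  have hI : Icc c d ⊆ openI a b := (ordConnected_openI a b).out hc hd
  obtain ⟨hy0, hy₁0, hrf'⟩ := hy.eq_zero_of_ae_eq_zero ((isOpen_openI a b).sdiff hS.isClosed)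
    sdiff_subset (h.ae_one_div_p_ne_zero.mono fun x hp hx ↦ hp hx.1) <| by
      filter_upwards [h.ae_weight_iff.1 hfy, h.ae_weight_iff.1 hfS] with x hfx hfSx hx
      rw [← hfx hx.1, hfSx hx.1 hx.2]
  have hf_eq : f =ᵐ[weight a b r] (Icc c d).indicator y := by
    filter_upwards [hfy, hfS] with x hfx hfSx
    by_cases hx : x ∈ Icc c d
    · rw [hfx, indicator_of_mem hx]
    · rw [hfSx fun hxS ↦ hx (Ioo_subset_Icc_self (hScd hxS)), indicator_of_notMem hx]
  have hf'_eq : ∀ᵐ x ∂(weight a b r), x ∉ Icc c d → f' x = 0 := h.ae_weight_iff.2 <| by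
    filter_upwards [hrf', ae_restrict_openI_iff.1 h.r_pos] with x hx hr hxab hxcd
    have hrx : (r x : ℂ) ≠ 0 := mod_cast (hr hxab).ne'
    simpa [hrx] using hx ⟨hxab, fun hxS ↦ hxcd (Ioo_subset_Icc_self (hScd hxS))⟩
  have hcS : c ∈ openI a b \ S := ⟨hc, fun h ↦ (hScd h).1.false⟩
  have hdS : d ∈ openI a b \ S := ⟨hd, fun h ↦ (hScd h).2.false⟩
  have hbracket := h.inner_sub_inner_eq_bracket hcd hI hf_eq hf'_eq (hgz.mono fun x hx _ ↦ hx)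
    (hy.mono hI) (hz.mono hI)
  rw [hy0 hcS, hy0 hdS, hy₁0 hcS, hy₁0 hdS] at hbracket
  exact sub_eq_zero.1 (hbracket.trans (by simp))

theorem isClosable_Tmax (h : IsCoefficients a b p q r)
    (hdense : Dense ((Tmin0 a b p q r).domain : Set (L2 a b r))) :
    (Tmax a b p q r).IsClosable := by
  refine (LinearPMap.adjoint_isClosed hdense).isClosable.leIsClosable
    (LinearPMap.IsFormalAdjoint.le_adjoint hdense fun x y ↦ ?_)
  obtain ⟨hx, hxS⟩ := (mem_graph_Tmin0 h _ _).1 (LinearPMap.mem_graph _ x)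
  have hy := (mem_graph_Tmax h _ _).1 (LinearPMap.mem_graph _ y)
  rw [← inner_conj_symm, hx.inner_eq_of_compactlySupported h hxS hy, inner_conj_symm]

end Operators

section Density

lemma exists_Icc_setIntegral_lt {f : ℝ → ℝ} {s : Set ℝ} (hs : IsOpen s)
    (hf : LocallyIntegrableOn f s) {x ε : ℝ} (hx : x ∈ s) (hε : 0 < ε) :
    ∃ c d, c < x ∧ x < d ∧ Icc c d ⊆ s ∧ ∫ t in Icc c d, f t < ε := by
  obtain ⟨δ, hδ, hδs⟩ := Metric.nhds_basis_closedBall.mem_iff.1 (hs.mem_nhds hx)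
  have hfδ : Integrable ((Metric.closedBall x δ).indicator f) :=
    (hf.integrableOn_compact_subset hδs (isCompact_closedBall x δ)).integrable_indicator
      Metric.isClosed_closedBall.measurableSet
  have hvol : Tendsto (fun η : ℝ ↦ volume (Icc (x - η) (x + η))) (𝓝[>] 0) (𝓝 0) := by
    refine (Continuous.tendsto' (f := fun η : ℝ ↦ volume (Icc (x - η) (x + η))) ?_ 0 0 ?_).mono_left
      nhdsWithin_le_nhds
    · simp only [Real.volume_Icc]
      exact ENNReal.continuous_ofReal.comp (by fun_prop)
    · simp
  have hsmall := (hfδ.tendsto_setIntegral_nhds_zero hvol).eventually_lt_const hε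
  obtain ⟨η, hη, hη0, hηδ⟩ := (hsmall.and (Ioo_mem_nhdsGT hδ)).exists
  have hsub : Icc (x - η) (x + η) ⊆ Metric.closedBall x δ := by
    rw [Real.closedBall_eq_Icc]
    exact Icc_subset_Icc (by linarith) (by linarith)
  rw [setIntegral_congr_fun measurableSet_Icc
    fun t ht ↦ indicator_of_mem (hsub ht) f] at hη
  exact ⟨x - η, x + η, by linarith, by linarith, hsub.trans hδs, hη⟩

variable {a b : EReal} {p q r : ℝ → ℝ} {c d : ℝ}

namespace IsCoefficients

lemma exists_truncatedSolution_L2 (h : IsCoefficients a b p q r) (hI : Icc c d ⊆ openI a b)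
    (hsmall : ∫ x in Icc c d, (‖1 / p x‖ + ‖q x‖) < 1) (g : L2 a b r) (e : ℝ) (α β : ℂ) :
    ∃ (y y₁ : ℝ → ℂ) (Y : L2 a b r), y e = α ∧ y₁ e = β ∧
      IsTruncatedSolution c d (fun x ↦ 1 / p x) q (fun x ↦ r x * g x) y y₁ ∧
      Y =ᵐ[weight a b r] (Icc c d).indicator y := by
  obtain ⟨y, y₁, hye, hy₁e, hy⟩ := exists_isTruncatedSolution
    (h.locInt_inv_p.integrableOn_compact_subset hI isCompact_Icc)
    (h.locInt_q.integrableOn_compact_subset hI isCompact_Icc)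
    (h.integrableOn_mul_of_isCompact isCompact_Icc hI g) hsmall e α β
  obtain ⟨Y, hY⟩ := h.exists_L2_eq_indicator isCompact_Icc hI
    ((hy.acLoc.continuousOn_of_isOpen isOpen_univ).mono (subset_univ _))
  exact ⟨y, y₁, Y, hye, hy₁e, hy, hY⟩

lemma mem_graph_Tmin0_of_isTruncatedSolution (h : IsCoefficients a b p q r)
    (hI : Icc c d ⊆ openI a b) {F k : L2 a b r} {f f₁ : ℝ → ℂ}
    (hF : F =ᵐ[weight a b r] (Icc c d).indicator f)
    (hk : ∀ᵐ x ∂(weight a b r), x ∉ Icc c d → k x = 0)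
    (hf : IsTruncatedSolution c d (fun x ↦ 1 / p x) q (fun x ↦ r x * k x) f f₁)
    (hc : f c = 0 ∧ f₁ c = 0) (hd : f d = 0 ∧ f₁ d = 0) : (F, k) ∈ (Tmin0 a b p q r).graph := by
  refine (mem_graph_Tmin0 h F k).2 ⟨h.tauRel_iff.2 ⟨f, f₁, ?_, ?_⟩, Icc c d, isCompact_Icc, hI, ?_⟩
  · filter_upwards [hF] with x hFx
    rw [hFx, indicator_apply_eq_self]
    exact fun hx ↦ (hf.eq_zero_of_notMem hc hd hx).1
  · refine ((hf.isSystemSolution_univ hc hd).mono (subset_univ _)).congr_ae ?_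
    filter_upwards [h.ae_weight_iff.1 hk] with x hkx hx
    rw [indicator_apply_eq_self]
    exact fun hxI ↦ by rw [hkx hx hxI, mul_zero]
  · filter_upwards [hF] with x hFx hx
    rw [hFx, indicator_of_notMem hx]

/-- Solving `τ f = k` from `c` with zero data, the values of `(f, f^{[1]})` at `d` are the inner
products of `k` with a fundamental system of `τ y = 0`. -/
lemma exists_preimage_of_inner_eq_zero (h : IsCoefficients a b p q r) (hcd : c ≤ d)
    (hI : Icc c d ⊆ openI a b) (hsmall : ∫ x in Icc c d, (‖1 / p x‖ + ‖q x‖) < 1)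
    {k V Z : L2 a b r} {v v₁ z z₁ : ℝ → ℂ} (hk : ∀ᵐ x ∂(weight a b r), x ∉ Icc c d → k x = 0)
    (hV : V =ᵐ[weight a b r] (Icc c d).indicator v) (hZ : Z =ᵐ[weight a b r] (Icc c d).indicator z)
    (hv : IsSystemSolution (Icc c d) (fun x ↦ 1 / p x) q (fun x ↦ r x * (0 : L2 a b r) x) v v₁)
    (hz : IsSystemSolution (Icc c d) (fun x ↦ 1 / p x) q (fun x ↦ r x * (0 : L2 a b r) x) z z₁)
    (hvd : v d = 1 ∧ v₁ d = 0) (hzd : z d = 0 ∧ z₁ d = 1) (hVk : ⟪V, k⟫_ℂ = 0)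
    (hZk : ⟪Z, k⟫_ℂ = 0) :
    ∃ (F : L2 a b r) (f f₁ : ℝ → ℂ), (F, k) ∈ (Tmin0 a b p q r).graph ∧
      F =ᵐ[weight a b r] (Icc c d).indicator f ∧
      IsSystemSolution (Icc c d) (fun x ↦ 1 / p x) q (fun x ↦ r x * k x) f f₁ ∧
      (f c = 0 ∧ f₁ c = 0) ∧ (f d = 0 ∧ f₁ d = 0) := by
  obtain ⟨f, f₁, F, hfc, hf₁c, hf, hF⟩ := h.exists_truncatedSolution_L2 hI hsmall k c 0 0
  have hVbracket := h.inner_sub_inner_eq_bracket hcd hI hF hk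
    (hV.mono fun x hx hxI ↦ hx.trans (indicator_of_mem hxI v)) hf.isSystemSolution_Icc hv
  have hZbracket := h.inner_sub_inner_eq_bracket hcd hI hF hk
    (hZ.mono fun x hx hxI ↦ hx.trans (indicator_of_mem hxI z)) hf.isSystemSolution_Icc hz
  have hfd : f d = 0 := by simpa [hZk, hzd, hfc, hf₁c] using hZbracket.symm
  have hf₁d : f₁ d = 0 := by simpa [hVk, hvd, hfc, hf₁c] using hVbracket.symm
  exact ⟨F, f, f₁, h.mem_graph_Tmin0_of_isTruncatedSolution hI hF hk hf ⟨hfc, hf₁c⟩ ⟨hfd, hf₁d⟩,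
    hF, hf.isSystemSolution_Icc, ⟨hfc, hf₁c⟩, ⟨hfd, hf₁d⟩⟩

lemma exists_solution_inner_eq_zero (h : IsCoefficients a b p q r) (hI : Icc c d ⊆ openI a b)
    (hsmall : ∫ x in Icc c d, (‖1 / p x‖ + ‖q x‖) < 1) (g : L2 a b r) {V Z : L2 a b r}
    {v v₁ z z₁ : ℝ → ℂ} (hV : V =ᵐ[weight a b r] (Icc c d).indicator v)
    (hZ : Z =ᵐ[weight a b r] (Icc c d).indicator z)
    (hv : IsSystemSolution (Icc c d) (fun x ↦ 1 / p x) q (fun x ↦ r x * (0 : L2 a b r) x) v v₁)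
    (hz : IsSystemSolution (Icc c d) (fun x ↦ 1 / p x) q (fun x ↦ r x * (0 : L2 a b r) x) z z₁) :
    ∃ (y y₁ : ℝ → ℂ) (k : L2 a b r), ⟪V, k⟫_ℂ = 0 ∧ ⟪Z, k⟫_ℂ = 0 ∧
      k =ᵐ[weight a b r] (Icc c d).indicator y ∧
      IsSystemSolution (Icc c d) (fun x ↦ 1 / p x) q (fun x ↦ r x * g x) y y₁ := by
  obtain ⟨u, u₁, U, -, -, hu, hU⟩ := h.exists_truncatedSolution_L2 hI hsmall g d 0 0
  have : FiniteDimensional ℂ (Submodule.span ℂ {V, Z}) :=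
    FiniteDimensional.span_of_finite ℂ (toFinite _)
  obtain ⟨N, hN, k, hk, rfl⟩ := (Submodule.span ℂ {V, Z}).exists_add_mem_mem_orthogonal U
  obtain ⟨s, t, rfl⟩ := Submodule.mem_span_pair.1 hN
  refine ⟨_, _, k, hk V (Submodule.mem_span_of_mem (mem_insert V {Z})),
    hk Z (Submodule.mem_span_of_mem (mem_insert_of_mem V rfl)), ?_,
    ((hu.isSystemSolution_Icc.sub_const_mul hv s).sub_const_mul hz t).congr_ae ?_⟩
  · filter_upwards [hU, hV, hZ, Lp.coeFn_add (s • V + t • Z) k, Lp.coeFn_add (s • V) (t • Z),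
      Lp.coeFn_smul s V, Lp.coeFn_smul t Z] with x hUx hVx hZx hNk hsum hsV htZ
    rw [hNk, Pi.add_apply, hsum, Pi.add_apply, hsV, htZ, Pi.smul_apply, Pi.smul_apply, hVx,
      hZx] at hUx
    rw [← sub_eq_of_eq_add' hUx.symm]
    by_cases hx : x ∈ Icc c d
    · simp only [indicator_of_mem hx, smul_eq_mul]
      ring
    · simp only [indicator_of_notMem hx, smul_zero, add_zero, sub_zero]
  · filter_upwards [h.ae_weight_iff.1 (Lp.coeFn_zero ℂ 2 (weight a b r))] with x h0 hx
    rw [h0 (hI hx), Pi.zero_apply]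
    ring

theorem ae_eq_zero_of_mem_orthogonal (h : IsCoefficients a b p q r) (hcd : c ≤ d)
    (hI : Icc c d ⊆ openI a b) (hsmall : ∫ x in Icc c d, (‖1 / p x‖ + ‖q x‖) < 1)
    {g : L2 a b r} (hg : g ∈ (Tmin0 a b p q r).domainᗮ) : ∀ᵐ x, x ∈ Ioo c d → g x = 0 := by
  obtain ⟨v, v₁, V, hvd, hv₁d, hv, hV⟩ := h.exists_truncatedSolution_L2 hI hsmall 0 d 1 0
  obtain ⟨z, z₁, Z, hzd, hz₁d, hz, hZ⟩ := h.exists_truncatedSolution_L2 hI hsmall 0 d 0 1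
  obtain ⟨y, y₁, k, hVk, hZk, hky, hy⟩ := h.exists_solution_inner_eq_zero hI hsmall g hV hZ
    hv.isSystemSolution_Icc hz.isSystemSolution_Icc
  have hk_off : ∀ᵐ x ∂(weight a b r), x ∉ Icc c d → k x = 0 :=
    hky.mono fun x hx hxI ↦ hx.trans (indicator_of_notMem hxI _)
  have hk_on : ∀ᵐ x ∂(weight a b r), x ∈ Icc c d → k x = y x :=
    hky.mono fun x hx hxI ↦ hx.trans (indicator_of_mem hxI _)
  obtain ⟨F, f, f₁, hFk, hF, hf, hfc, hfd⟩ := h.exists_preimage_of_inner_eq_zero hcd hI hsmall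
    hk_off hV hZ hv.isSystemSolution_Icc hz.isSystemSolution_Icc ⟨hvd, hv₁d⟩ ⟨hzd, hz₁d⟩ hVk hZk
  have hgF : ⟪g, F⟫_ℂ = 0 :=
    (Submodule.mem_orthogonal' _ g).1 hg F (LinearPMap.mem_domain_of_mem_graph hFk)
  have hk : k = 0 := by
    simpa [hgF, hfc, hfd] using h.inner_sub_inner_eq_bracket hcd hI hF hk_off hk_on hf hy
  obtain ⟨-, -, hrg⟩ := hy.eq_zero_of_ae_eq_zero isOpen_Ioo Ioo_subset_Icc_self
    (h.ae_one_div_p_ne_zero.mono fun x hp hx ↦ hp (hI (Ioo_subset_Icc_self hx))) <| by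
      filter_upwards [h.ae_weight_iff.1 hk_on,
        h.ae_weight_iff.1 (Lp.eq_zero_iff_ae_eq_zero.1 hk)] with x hkx h0 hx
      have hxI := Ioo_subset_Icc_self hx
      rw [← hkx (hI hxI) hxI, h0 (hI hxI), Pi.zero_apply]
  filter_upwards [hrg, ae_restrict_openI_iff.1 h.r_pos] with x hx hr hxI
  exact (mul_eq_zero.1 (hx hxI)).resolve_left
    (mod_cast (hr (hI (Ioo_subset_Icc_self hxI))).ne')

theorem dense_domain_Tmin0 (h : IsCoefficients a b p q r) :
    Dense ((Tmin0 a b p q r).domain : Set (L2 a b r)) := by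
  rw [Submodule.dense_iff_topologicalClosure_eq_top, Submodule.topologicalClosure_eq_top_iff,
    Submodule.eq_bot_iff]
  intro g hg
  have hpq : LocallyIntegrableOn (fun x ↦ ‖1 / p x‖ + ‖q x‖) (openI a b) :=
    h.locInt_inv_p.norm.add h.locInt_q.norm
  refine (Lp.eq_zero_iff_ae_eq_zero).2 (h.ae_weight_iff.2 ?_)
  refine measure_null_of_locally_null _ fun x hx ↦ ?_
  have hxI : x ∈ openI a b := by
    by_contra hxI
    exact hx fun hxI' ↦ absurd hxI' hxI
  obtain ⟨c, d, hcx, hxd, hI, hsmall⟩ :=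
    exists_Icc_setIntegral_lt (isOpen_openI a b) hpq hxI one_pos
  refine ⟨_, inter_mem_nhdsWithin _ (Ioo_mem_nhds hcx hxd), measure_mono_null (fun y hy ↦ ?_)
    (ae_iff.1 (h.ae_eq_zero_of_mem_orthogonal (hcx.trans hxd).le hI hsmall hg))⟩
  exact fun hgy ↦ hy.1 fun _ ↦ hgy hy.2

end IsCoefficients

end Density

section Invariance

variable {H : Type*} [NormedAddCommGroup H] [InnerProductSpace ℂ H] {K J : H →L[ℂ] H}
  {T : H →ₗ.[ℂ] H}

lemma mapsTo_graph_closure (hclosable : T.IsClosable)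
    (hT : MapsTo (K.prodMap J) T.graph T.graph) :
    MapsTo (K.prodMap J) T.closure.graph T.closure.graph := by
  rw [← hclosable.graph_closure_eq_closure_graph]
  exact hT.closure (K.prodMap J).continuous

variable [CompleteSpace H] {K' J' : H →L[ℂ] H}

lemma mem_graph_conjOp {f g : H} :
    (f, g) ∈ (conjOp K T).graph ↔
      ∃ h, (K f, h) ∈ T.graph ∧ ContinuousLinearMap.adjoint K h = g := by
  constructor
  · intro hfg
    obtain ⟨x, rfl, rfl⟩ := (LinearPMap.mem_graph_iff _).1 hfg
    exact ⟨T ⟨K x, x.2⟩, T.mem_graph ⟨K x, x.2⟩, rfl⟩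
  · rintro ⟨h, hKf, rfl⟩
    obtain ⟨⟨u, hu⟩, huK, rfl⟩ := (LinearPMap.mem_graph_iff _).1 hKf
    obtain rfl : u = K f := huK
    exact (LinearPMap.mem_graph_iff _).2 ⟨⟨f, hu⟩, rfl, rfl⟩

lemma conjOp_eq_self_of_mapsTo_graph (hK'K : K' * K = 1)
    (hKJ : ContinuousLinearMap.adjoint K * J = 1)
    (hT : MapsTo (K.prodMap J) T.graph T.graph) (hT' : MapsTo (K'.prodMap J') T.graph T.graph) :
    conjOp K T = T := by
  refine LinearPMap.eq_of_eq_graph (Submodule.ext fun ⟨f, g⟩ ↦ mem_graph_conjOp.trans ⟨?_, ?_⟩)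
  · rintro ⟨h, hKf, rfl⟩
    have hf : (f, J' h) ∈ T.graph := by
      have hK'Kf : (K' (K f), J' h) ∈ T.graph := hT' hKf
      rwa [show K' (K f) = f from DFunLike.congr_fun hK'K f] at hK'Kf
    have hJJ' : h = J (J' h) := T.mem_graph_snd_inj hKf (hT hf) rfl
    rw [hJJ', show ContinuousLinearMap.adjoint K (J (J' h)) = J' h from DFunLike.congr_fun hKJ _]
    exact hf
  · exact fun hfg ↦ ⟨J g, hT hfg, DFunLike.congr_fun hKJ g⟩

theorem kInvariant_of_mapsTo_graph (hK'K : K' * K = 1) (hKK' : K * K' = 1)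
    (hKJ : ContinuousLinearMap.adjoint K * J = 1) (hdense : Dense (T.domain : Set H))
    (hclosable : T.IsClosable) (hT : MapsTo (K.prodMap J) T.graph T.graph)
    (hT' : MapsTo (K'.prodMap J') T.graph T.graph) : KInvariant K T where
  isUnit := ⟨⟨K, K', hKK', hK'K⟩, rfl⟩
  dense_domain := hdense
  isClosable := hclosable
  conj_eq := conjOp_eq_self_of_mapsTo_graph hK'K hKJ hT hT'

end Invariance

section IncreasingDiffeo

/-- `φ` is an increasing `C¹` diffeomorphism of the open interval `s` onto itself, with derivative
`φ'` and inverse `ψ`. -/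
structure IsIncreasingDiffeo (s : Set ℝ) (φ φ' ψ : ℝ → ℝ) : Prop where
  isOpen : IsOpen s
  ordConnected : s.OrdConnected
  mapsTo : MapsTo φ s s
  mapsTo_inv : MapsTo ψ s s
  invOn : InvOn ψ φ s s
  hasDerivAt : ∀ x ∈ s, HasDerivAt φ (φ' x) x
  deriv_pos : ∀ x ∈ s, 0 < φ' x
  continuousOn_deriv : ContinuousOn φ' s

namespace IsIncreasingDiffeo

variable {s : Set ℝ} {φ φ' ψ : ℝ → ℝ}

lemma continuousOn (D : IsIncreasingDiffeo s φ φ' ψ) : ContinuousOn φ s :=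
  fun x hx ↦ (D.hasDerivAt x hx).continuousAt.continuousWithinAt

lemma strictMonoOn (D : IsIncreasingDiffeo s φ φ' ψ) : StrictMonoOn φ s :=
  strictMonoOn_of_hasDerivWithinAt_pos D.ordConnected.convex D.continuousOn
    (fun x hx ↦ (D.hasDerivAt x (interior_subset hx)).hasDerivWithinAt)
    fun x hx ↦ D.deriv_pos x (interior_subset hx)

lemma image_eq (D : IsIncreasingDiffeo s φ φ' ψ) : φ '' s = s :=
  (D.invOn.bijOn D.mapsTo D.mapsTo_inv).image_eq

lemma continuousOn_inv (D : IsIncreasingDiffeo s φ φ' ψ) : ContinuousOn ψ s := by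
  intro x hx
  have hmono : MonotoneOn ψ s := fun x hx y hy hxy ↦
    (D.strictMonoOn.le_iff_le (D.mapsTo_inv hx) (D.mapsTo_inv hy)).1 <| by
      rwa [D.invOn.2 hx, D.invOn.2 hy]
  have himage : ψ '' s = s := (D.invOn.symm.bijOn D.mapsTo_inv D.mapsTo).image_eq
  exact (continuousAt_of_monotoneOn_of_image_mem_nhds hmono (D.isOpen.mem_nhds hx)
    (himage.symm ▸ D.isOpen.mem_nhds (D.mapsTo_inv hx))).continuousWithinAt

theorem symm (D : IsIncreasingDiffeo s φ φ' ψ) :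
    IsIncreasingDiffeo s ψ (fun x ↦ (φ' (ψ x))⁻¹) φ where
  isOpen := D.isOpen
  ordConnected := D.ordConnected
  mapsTo := D.mapsTo_inv
  mapsTo_inv := D.mapsTo
  invOn := D.invOn.symm
  hasDerivAt _ hx :=
    (D.hasDerivAt _ (D.mapsTo_inv hx)).of_local_left_inverse
      (D.continuousOn_inv.continuousAt (D.isOpen.mem_nhds hx))
      (D.deriv_pos _ (D.mapsTo_inv hx)).ne' (eventually_of_mem (D.isOpen.mem_nhds hx) D.invOn.2)
  deriv_pos _ hx := inv_pos.2 (D.deriv_pos _ (D.mapsTo_inv hx))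
  continuousOn_deriv := (D.continuousOn_deriv.comp D.continuousOn_inv D.mapsTo_inv).inv₀
    fun _ hx ↦ (D.deriv_pos _ (D.mapsTo_inv hx)).ne'

lemma acLoc (D : IsIncreasingDiffeo s φ φ' ψ) : ACLoc s φ := by
  intro c hc d hd
  have hsub := D.ordConnected.uIcc_subset hc hd
  obtain ⟨M, hM⟩ := isCompact_uIcc.exists_bound_of_continuousOn (D.continuousOn_deriv.mono hsub)
  exact ((convex_uIcc c d).lipschitzOnWith_of_nnnorm_hasDerivWithin_le (C := M.toNNReal)
    (fun x hx ↦ (D.hasDerivAt x (hsub hx)).hasDerivWithinAt)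
    fun x hx ↦ NNReal.le_toNNReal_of_coe_le (hM x hx)).absolutelyContinuousOnInterval

lemma acLoc_comp (D : IsIncreasingDiffeo s φ φ' ψ) {E : Type*} [NormedAddCommGroup E] {y : ℝ → E}
    (hy : ACLoc s y) : ACLoc s (fun x ↦ y (φ x)) :=
  have := D.ordConnected
  hy.comp_monotoneOn D.acLoc D.strictMonoOn.monotoneOn D.mapsTo

theorem ae_comp (D : IsIncreasingDiffeo s φ φ' ψ) {S : ℝ → Prop} (hS : ∀ᵐ x, x ∈ s → S x) :
    ∀ᵐ x, x ∈ s → S (φ x) := by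
  have hψ : DifferentiableOn ℝ ψ {x | ¬(x ∈ s → S x)} := fun x hx ↦
    (D.symm.hasDerivAt x (Classical.not_imp.1 hx).1).differentiableAt.differentiableWithinAt
  refine measure_mono_null (fun x hx ↦ ?_)
    (addHaar_image_eq_zero_of_differentiableOn_of_addHaar_eq_zero volume hψ hS)
  obtain ⟨hxs, hSx⟩ := Classical.not_imp.1 hx
  exact ⟨φ x, fun hφx ↦ hSx (hφx (D.mapsTo hxs)), D.invOn.1 hxs⟩

lemma setLIntegral_comp (D : IsIncreasingDiffeo s φ φ' ψ) (G : ℝ → ℝ≥0∞) :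
    ∫⁻ x in s, ENNReal.ofReal (φ' x) * G (φ x) = ∫⁻ x in s, G x := by
  conv_rhs => rw [← D.image_eq]
  rw [lintegral_image_eq_lintegral_abs_deriv_mul D.isOpen.measurableSet
    (fun x hx ↦ (D.hasDerivAt x hx).hasDerivWithinAt) D.strictMonoOn.injOn]
  refine setLIntegral_congr_fun D.isOpen.measurableSet fun x hx ↦ ?_
  rw [abs_of_pos (D.deriv_pos x hx)]

lemma setIntegral_comp (D : IsIncreasingDiffeo s φ φ' ψ) {E : Type*} [NormedAddCommGroup E]
    [NormedSpace ℝ E] (G : ℝ → E) : ∫ x in s, φ' x • G (φ x) = ∫ x in s, G x := by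
  conv_rhs => rw [← D.image_eq]
  rw [integral_image_eq_integral_abs_deriv_smul D.isOpen.measurableSet
    (fun x hx ↦ (D.hasDerivAt x hx).hasDerivWithinAt) D.strictMonoOn.injOn]
  refine setIntegral_congr_fun D.isOpen.measurableSet fun x hx ↦ ?_
  rw [abs_of_pos (D.deriv_pos x hx)]

end IsIncreasingDiffeo

end IncreasingDiffeo

section WeightedComposition

lemma exists_continuousLinearMap_smul_comp {α E 𝕜 : Type*} [MeasurableSpace α] {μ : Measure α}
    [NormedAddCommGroup E] [NormedSpace ℝ E] [NormedField 𝕜] [NormedSpace 𝕜 E]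
    [SMulCommClass ℝ 𝕜 E] {p : ℝ≥0∞} [Fact (1 ≤ p)] {φ : α → α} {B : α → ℝ} {M : ℝ≥0}
    (hφ : AEMeasurable φ μ) (hφμ : Tendsto φ (ae μ) (ae μ)) (hB : AEStronglyMeasurable B μ)
    (hM : ∀ f : Lp E p μ, eLpNorm (fun x ↦ B x • f (φ x)) p μ ≤ M * eLpNorm f p μ) :
    ∃ K : Lp E p μ →L[𝕜] Lp E p μ, ∀ f, K f =ᵐ[μ] fun x ↦ B x • f (φ x) := by
  have hmem (f : Lp E p μ) : MemLp (fun x ↦ B x • f (φ x)) p μ :=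
    ⟨hB.smul ((Lp.stronglyMeasurable f).aestronglyMeasurable.comp_aemeasurable hφ),
      (hM f).trans_lt (ENNReal.mul_lt_top ENNReal.coe_lt_top (Lp.eLpNorm_lt_top f))⟩
  let K : Lp E p μ →ₗ[𝕜] Lp E p μ :=
    { toFun := fun f ↦ (hmem f).toLp _
      map_add' := fun f g ↦ by
        rw [← MemLp.toLp_add]
        refine MemLp.toLp_congr _ _ ?_
        filter_upwards [hφμ.eventually (Lp.coeFn_add f g)] with x hx
        simp only [hx, Pi.add_apply, smul_add]
      map_smul' := fun k f ↦ by
        rw [RingHom.id_apply, ← MemLp.toLp_const_smul]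
        refine MemLp.toLp_congr _ _ ?_
        filter_upwards [hφμ.eventually (Lp.coeFn_smul k f)] with x hx
        simp only [hx, Pi.smul_apply, smul_comm (B x) k] }
  refine ⟨K.mkContinuous M fun f ↦ ?_, fun f ↦ (hmem f).coeFn_toLp⟩
  change ‖(hmem f).toLp _‖ ≤ _
  rw [Lp.norm_toLp, Lp.norm_def, ← ENNReal.coe_toReal, ← ENNReal.toReal_mul]
  exact ENNReal.toReal_mono
    (ENNReal.mul_lt_top ENNReal.coe_lt_top (Lp.eLpNorm_lt_top f)).ne (hM f)

variable {a b : EReal} {p q r φ φ' ψ A B : ℝ → ℝ} {C : ℝ}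

namespace IsCoefficients

lemma tendsto_ae_weight (h : IsCoefficients a b p q r)
    (D : IsIncreasingDiffeo (openI a b) φ φ' ψ) :
    Tendsto φ (ae (weight a b r)) (ae (weight a b r)) :=
  fun _ hS ↦ h.ae_weight_iff.2 (D.ae_comp (h.ae_weight_iff.1 hS))

lemma lintegral_weight_comp (h : IsCoefficients a b p q r)
    (D : IsIncreasingDiffeo (openI a b) φ φ' ψ) (hC : 0 ≤ C)
    (hr : ∀ᵐ x, x ∈ openI a b → r (φ x) = C * r x) (G : ℝ → ℝ≥0∞) :
    ∫⁻ x, ENNReal.ofReal (C * φ' x) * G (φ x) ∂(weight a b r) = ∫⁻ x, G x ∂(weight a b r) := by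
  have hweight (u : ℝ → ℝ≥0∞) :
      ∫⁻ x, u x ∂(weight a b r) = ∫⁻ x in openI a b, ENNReal.ofReal (r x) * u x :=
    lintegral_withDensity_eq_lintegral_mul_non_measurable₀ _ h.aemeasurable_r.ennreal_ofReal
      (Eventually.of_forall fun _ ↦ ENNReal.ofReal_lt_top) u
  rw [hweight, hweight]
  conv_rhs => rw [← D.setLIntegral_comp]
  refine setLIntegral_congr_fun_ae (isOpen_openI a b).measurableSet ?_
  filter_upwards [hr] with x hrx hx
  rw [hrx hx, ENNReal.ofReal_mul hC, ENNReal.ofReal_mul hC]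
  ring

lemma integral_weight_comp (h : IsCoefficients a b p q r)
    (D : IsIncreasingDiffeo (openI a b) φ φ' ψ)
    (hr : ∀ᵐ x, x ∈ openI a b → r (φ x) = C * r x) (G : ℝ → ℂ) :
    ∫ x, (C * φ' x) • G (φ x) ∂(weight a b r) = ∫ x, G x ∂(weight a b r) := by
  rw [h.integral_weight, h.integral_weight]
  conv_rhs => rw [← D.setIntegral_comp]
  refine setIntegral_congr_ae (isOpen_openI a b).measurableSet ?_
  filter_upwards [hr] with x hrx hx
  rw [hrx hx, Complex.real_smul, Complex.real_smul]
  push_cast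
  ring

lemma eLpNorm_sqrt_smul_comp (h : IsCoefficients a b p q r)
    (D : IsIncreasingDiffeo (openI a b) φ φ' ψ) (hC : 0 ≤ C)
    (hr : ∀ᵐ x, x ∈ openI a b → r (φ x) = C * r x) (f : ℝ → ℂ) :
    eLpNorm (fun x ↦ √(C * φ' x) • f (φ x)) 2 (weight a b r) = eLpNorm f 2 (weight a b r) := by
  rw [eLpNorm_eq_lintegral_rpow_enorm_toReal two_ne_zero ENNReal.ofNat_ne_top,
    eLpNorm_eq_lintegral_rpow_enorm_toReal two_ne_zero ENNReal.ofNat_ne_top]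
  conv_rhs => rw [← h.lintegral_weight_comp D hC hr]
  congr 1
  refine lintegral_congr_ae (h.ae_weight_iff.2 (Eventually.of_forall fun x hx ↦ ?_))
  have hφ' : 0 ≤ C * φ' x := mul_nonneg hC (D.deriv_pos x hx).le
  simp only [ENNReal.toReal_ofNat, ENNReal.rpow_ofNat, enorm_smul, mul_pow,
    Real.enorm_of_nonneg (Real.sqrt_nonneg _), ← ENNReal.ofReal_pow (Real.sqrt_nonneg _),
    Real.sq_sqrt hφ']

theorem exists_isWeightedComposition (h : IsCoefficients a b p q r)
    (D : IsIncreasingDiffeo (openI a b) φ φ' ψ) (hC : 0 < C)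
    (hr : ∀ᵐ x, x ∈ openI a b → r (φ x) = C * r x) (hB : ContinuousOn B (openI a b))
    (hbdd : BddAbove ((fun x ↦ B x ^ 2 / φ' x) '' openI a b)) :
    ∃ K : L2 a b r →L[ℂ] L2 a b r, IsWeightedComposition B φ K := by
  obtain ⟨M, hM⟩ := hbdd
  have hB_le (x : ℝ) (hx : x ∈ openI a b) : |B x| ≤ √(M / C) * √(C * φ' x) := by
    have hφ' := D.deriv_pos x hx
    have hBM : B x ^ 2 ≤ M * φ' x := (div_le_iff₀ hφ').1 (hM (mem_image_of_mem _ hx))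
    rw [← Real.sqrt_mul' _ (mul_pos hC hφ').le, ← mul_assoc, div_mul_cancel₀ _ hC.ne']
    exact Real.abs_le_sqrt hBM
  have hbound (f : ℝ → ℂ) : eLpNorm (fun x ↦ B x • f (φ x)) 2 (weight a b r) ≤
      (√(M / C)).toNNReal * eLpNorm f 2 (weight a b r) := by
    rw [← h.eLpNorm_sqrt_smul_comp D hC.le hr f]
    refine eLpNorm_le_mul_eLpNorm_of_ae_le_mul
      (h.ae_weight_iff.2 (Eventually.of_forall fun x hx ↦ ?_)) 2
    rw [norm_smul, norm_smul, ← mul_assoc, Real.norm_of_nonneg (Real.sqrt_nonneg _)]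
    exact mul_le_mul_of_nonneg_right (hB_le x hx) (norm_nonneg _)
  have hac : weight a b r ≪ volume.restrict (openI a b) := withDensity_absolutelyContinuous _ _
  have hmeas := (isOpen_openI a b).measurableSet
  exact exists_continuousLinearMap_smul_comp ((D.continuousOn.aemeasurable hmeas).mono_ac hac)
    (h.tendsto_ae_weight D) ((hB.aestronglyMeasurable hmeas).mono_ac hac) fun f ↦ hbound f

end IsCoefficients

namespace IsWeightedComposition

variable {K K' J : L2 a b r →L[ℂ] L2 a b r}

lemma unique (hK : IsWeightedComposition A φ K) (hK' : IsWeightedComposition A φ K') : K = K' :=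
  ContinuousLinearMap.ext fun f ↦ Lp.ext ((hK f).trans (hK' f).symm)

lemma mul_eq_one (h : IsCoefficients a b p q r) (D : IsIncreasingDiffeo (openI a b) φ φ' ψ)
    (hK : IsWeightedComposition A φ K) (hK' : IsWeightedComposition B ψ K')
    (hAB : ∀ x ∈ openI a b, A x * B (φ x) = 1) : K * K' = 1 := by
  refine ContinuousLinearMap.ext fun f ↦ Lp.ext ?_
  have hI : ∀ᵐ x ∂(weight a b r), x ∈ openI a b :=
    h.ae_weight_iff.2 (Eventually.of_forall fun _ hx ↦ hx)
  filter_upwards [hK (K' f), (h.tendsto_ae_weight D).eventually (hK' f), hI] with x hKx hK'x hx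
  calc K (K' f) x = (A x * B (φ x)) • f (ψ (φ x)) := by rw [hKx, hK'x, smul_smul]
    _ = f x := by rw [hAB x hx, D.invOn.1 hx, one_smul]

lemma adjoint_mul_eq_one (h : IsCoefficients a b p q r)
    (D : IsIncreasingDiffeo (openI a b) φ φ' ψ)
    (hr : ∀ᵐ x, x ∈ openI a b → r (φ x) = C * r x)
    (hK : IsWeightedComposition A φ K) (hJ : IsWeightedComposition B φ J)
    (hAB : ∀ x ∈ openI a b, A x * B x = C * φ' x) :
    ContinuousLinearMap.adjoint K * J = 1 := by
  refine ContinuousLinearMap.ext fun g ↦ ext_inner_left ℂ fun f ↦ ?_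
  have hinner (u v : L2 a b r) : ⟪u, v⟫_ℂ = ∫ x, v x * starRingEnd ℂ (u x) ∂(weight a b r) := rfl
  change ⟪f, ContinuousLinearMap.adjoint K (J g)⟫_ℂ = ⟪f, g⟫_ℂ
  rw [ContinuousLinearMap.adjoint_inner_right, hinner, hinner]
  conv_rhs => rw [← h.integral_weight_comp D hr]
  refine integral_congr_ae (h.ae_weight_iff.2 ?_)
  filter_upwards [h.ae_weight_iff.1 (hK f), h.ae_weight_iff.1 (hJ g)] with x hKx hJx hx
  rw [hKx hx, hJx hx, ← hAB x hx, Complex.real_smul, Complex.real_smul, Complex.real_smul, map_mul,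
    Complex.conj_ofReal]
  push_cast
  ring

lemma apply_mem_compactlySupported (h : IsCoefficients a b p q r)
    (D : IsIncreasingDiffeo (openI a b) φ φ' ψ) (hK : IsWeightedComposition A φ K) {f : L2 a b r}
    (hf : f ∈ compactlySupported a b r) : K f ∈ compactlySupported a b r := by
  obtain ⟨S, hS, hSI, hfS⟩ := hf
  refine ⟨ψ '' S, hS.image_of_continuousOn (D.continuousOn_inv.mono hSI),
    (image_mono hSI).trans D.mapsTo_inv.image_subset, h.ae_weight_iff.2 ?_⟩
  filter_upwards [h.ae_weight_iff.1 (hK f),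
    h.ae_weight_iff.1 ((h.tendsto_ae_weight D).eventually hfS)] with x hKx hfx hx hxS
  rw [hKx hx, hfx hx fun hφx ↦ hxS ⟨φ x, hφx, D.invOn.1 hx⟩, smul_zero]

end IsWeightedComposition

end WeightedComposition

section Symmetry

/-- The substitution `y ↦ A · (y ∘ φ)` preserves the form of the first-order system `y' = P y₁`,
`y₁' = Q y - w`; `A₁` is the companion of `A`, that is `A₁ = A^{[1]}` when `P = 1 / p`. The inverse
`ψ` of `φ` is carried along to make the notion symmetric. -/
structure IsSystemSymmetry (s : Set ℝ) (P Q A A₁ φ φ' ψ : ℝ → ℝ) : Prop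
    extends IsIncreasingDiffeo s φ φ' ψ where
  acLoc_A : ACLoc s A
  acLoc_A₁ : ACLoc s A₁
  A_ne_zero : ∀ x ∈ s, A x ≠ 0
  hasDerivAt_A : ∀ᵐ x, x ∈ s → HasDerivAt A (P x * A₁ x) x
  hasDerivAt_A₁ : ∀ᵐ x, x ∈ s → HasDerivAt A₁ (A x * Q x - φ' x / A x * Q (φ x)) x
  eq_P : ∀ᵐ x, x ∈ s → P x = A x ^ 2 * φ' x * P (φ x)

namespace IsSystemSymmetry

variable {s : Set ℝ} {P Q A A₁ φ φ' ψ : ℝ → ℝ}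

theorem symm (S : IsSystemSymmetry s P Q A A₁ φ φ' ψ) :
    IsSystemSymmetry s P Q (fun x ↦ (A (ψ x))⁻¹) (fun x ↦ -A₁ (ψ x)) ψ
      (fun x ↦ (φ' (ψ x))⁻¹) φ where
  toIsIncreasingDiffeo := S.toIsIncreasingDiffeo.symm
  acLoc_A :=
    have := S.ordConnected
    (S.toIsIncreasingDiffeo.symm.acLoc_comp S.acLoc_A).inv
      fun x hx ↦ S.A_ne_zero _ (S.mapsTo_inv hx)
  acLoc_A₁ := fun c hc d hd ↦ (S.toIsIncreasingDiffeo.symm.acLoc_comp S.acLoc_A₁ c hc d hd).fun_neg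
  A_ne_zero := fun x hx ↦ inv_ne_zero (S.A_ne_zero _ (S.mapsTo_inv hx))
  hasDerivAt_A := by
    have D := S.toIsIncreasingDiffeo.symm
    filter_upwards [D.ae_comp S.hasDerivAt_A, D.ae_comp S.eq_P] with x hAx hPx hx
    have hA := S.A_ne_zero _ (S.mapsTo_inv hx)
    have hφ' := (S.deriv_pos _ (S.mapsTo_inv hx)).ne'
    refine (((hAx hx).comp x (D.hasDerivAt x hx)).inv hA).congr_deriv ?_
    simp only [Function.comp_apply]
    rw [hPx hx, S.invOn.2 hx]
    field_simp
  hasDerivAt_A₁ := by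
    have D := S.toIsIncreasingDiffeo.symm
    filter_upwards [D.ae_comp S.hasDerivAt_A₁] with x hA₁x hx
    have hA := S.A_ne_zero _ (S.mapsTo_inv hx)
    have hφ' := (S.deriv_pos _ (S.mapsTo_inv hx)).ne'
    refine ((hA₁x hx).comp x (D.hasDerivAt x hx)).fun_neg.congr_deriv ?_
    rw [S.invOn.2 hx]
    field_simp
    ring
  eq_P := by
    have D := S.toIsIncreasingDiffeo.symm
    filter_upwards [D.ae_comp S.eq_P] with x hPx hx
    have hA := S.A_ne_zero _ (S.mapsTo_inv hx)
    have hφ' := (S.deriv_pos _ (S.mapsTo_inv hx)).ne'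
    rw [hPx hx, S.invOn.2 hx]
    field_simp

theorem isSystemSolution (S : IsSystemSymmetry s P Q A A₁ φ φ' ψ) {w y y₁ : ℝ → ℂ}
    (hy : IsSystemSolution s P Q w y y₁) :
    IsSystemSolution s P Q (fun x ↦ (φ' x / A x) • w (φ x)) (fun x ↦ A x • y (φ x))
      (fun x ↦ A₁ x • y (φ x) + (A x)⁻¹ • y₁ (φ x)) where
  acLoc := S.acLoc_A.smul (S.acLoc_comp hy.acLoc)
  acLoc₁ :=
    have := S.ordConnected
    (S.acLoc_A₁.smul (S.acLoc_comp hy.acLoc)).add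
      ((S.acLoc_A.inv S.A_ne_zero).smul (S.acLoc_comp hy.acLoc₁))
  hasDerivAt := by
    filter_upwards [S.hasDerivAt_A, S.ae_comp hy.hasDerivAt, S.eq_P] with x hAx hyx hPx hx
    have hA : (A x : ℂ) ≠ 0 := mod_cast S.A_ne_zero x hx
    refine ((hAx hx).smul ((hyx hx).scomp x (S.hasDerivAt x hx))).congr_deriv ?_
    simp only [Complex.real_smul, Function.comp_apply, hPx hx]
    push_cast
    field_simp
    ring
  hasDerivAt₁ := by
    filter_upwards [S.hasDerivAt_A, S.hasDerivAt_A₁, S.ae_comp hy.hasDerivAt,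
      S.ae_comp hy.hasDerivAt₁, S.eq_P] with x hAx hA₁x hyx hy₁x hPx hx
    have hA : (A x : ℂ) ≠ 0 := mod_cast S.A_ne_zero x hx
    refine (((hA₁x hx).smul ((hyx hx).scomp x (S.hasDerivAt x hx))).add
      (((hAx hx).inv (S.A_ne_zero x hx)).smul
        ((hy₁x hx).scomp x (S.hasDerivAt x hx)))).congr_deriv ?_
    simp only [Complex.real_smul, Function.comp_apply, Pi.inv_apply, hPx hx]
    push_cast
    field_simp
    ring

end IsSystemSymmetry

/-- The substitution `f ↦ A · (f ∘ φ)` is bounded with bounded inverse in `L²((a, b); r dx)` and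
preserves the form of the equation `τ f = g`. -/
structure IsLiouvilleSymmetry (a b : EReal) (p q r A A₁ φ φ' ψ : ℝ → ℝ) (C : ℝ) : Prop
    extends IsSystemSymmetry (openI a b) (fun x ↦ 1 / p x) q A A₁ φ φ' ψ where
  C_pos : 0 < C
  eq_r : ∀ᵐ x, x ∈ openI a b → r (φ x) = C * r x
  bddAbove : BddAbove ((fun x ↦ A x ^ 2 / φ' x) '' openI a b)
  bddAbove_inv : BddAbove ((fun x ↦ φ' x / A x ^ 2) '' openI a b)

namespace IsLiouvilleSymmetry

variable {a b : EReal} {p q r A A₁ φ φ' ψ : ℝ → ℝ} {C : ℝ}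

theorem symm (S : IsLiouvilleSymmetry a b p q r A A₁ φ φ' ψ C) :
    IsLiouvilleSymmetry a b p q r (fun x ↦ (A (ψ x))⁻¹) (fun x ↦ -A₁ (ψ x)) ψ
      (fun x ↦ (φ' (ψ x))⁻¹) φ C⁻¹ where
  toIsSystemSymmetry := S.toIsSystemSymmetry.symm
  C_pos := inv_pos.2 S.C_pos
  eq_r := by
    filter_upwards [S.toIsIncreasingDiffeo.symm.ae_comp S.eq_r] with x hrx hx
    rw [← S.invOn.2 hx, hrx hx, S.invOn.2 hx, inv_mul_cancel_left₀ S.C_pos.ne']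
  bddAbove := S.bddAbove_inv.mono <| by
    rintro _ ⟨x, hx, rfl⟩
    exact ⟨ψ x, S.mapsTo_inv hx, by simp only [div_eq_mul_inv, inv_pow, inv_inv, mul_comm]⟩
  bddAbove_inv := S.bddAbove.mono <| by
    rintro _ ⟨x, hx, rfl⟩
    exact ⟨ψ x, S.mapsTo_inv hx, by simp only [div_eq_mul_inv, inv_pow, inv_inv, mul_comm]⟩

theorem exists_isWeightedComposition (S : IsLiouvilleSymmetry a b p q r A A₁ φ φ' ψ C)
    (h : IsCoefficients a b p q r) : ∃ K : L2 a b r →L[ℂ] L2 a b r, IsWeightedComposition A φ K :=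
  h.exists_isWeightedComposition S.toIsIncreasingDiffeo S.C_pos S.eq_r
    (S.acLoc_A.continuousOn_of_isOpen S.isOpen) S.bddAbove

theorem exists_isWeightedComposition_dual (S : IsLiouvilleSymmetry a b p q r A A₁ φ φ' ψ C)
    (h : IsCoefficients a b p q r) :
    ∃ J : L2 a b r →L[ℂ] L2 a b r, IsWeightedComposition (fun x ↦ C * φ' x / A x) φ J := by
  refine h.exists_isWeightedComposition S.toIsIncreasingDiffeo S.C_pos S.eq_r
    ((continuousOn_const.mul S.continuousOn_deriv).div
      (S.acLoc_A.continuousOn_of_isOpen S.isOpen) S.A_ne_zero) ?_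
  obtain ⟨M, hM⟩ := S.bddAbove_inv
  refine ⟨C ^ 2 * M, ?_⟩
  rintro _ ⟨x, hx, rfl⟩
  have hφ' := (S.deriv_pos x hx).ne'
  have hA := S.A_ne_zero x hx
  calc (C * φ' x / A x) ^ 2 / φ' x = C ^ 2 * (φ' x / A x ^ 2) := by field_simp
    _ ≤ C ^ 2 * M := by gcongr; exact hM (mem_image_of_mem _ hx)

variable {K J : L2 a b r →L[ℂ] L2 a b r}

theorem tauRel_map (S : IsLiouvilleSymmetry a b p q r A A₁ φ φ' ψ C)
    (h : IsCoefficients a b p q r) (hK : IsWeightedComposition A φ K)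
    (hJ : IsWeightedComposition (fun x ↦ C * φ' x / A x) φ J) {f g : L2 a b r}
    (hfg : TauRel a b p q r f g) : TauRel a b p q r (K f) (J g) := by
  obtain ⟨y, y₁, hfy, hy⟩ := h.tauRel_iff.1 hfg
  refine h.tauRel_iff.2 ⟨_, _, ?_, (S.isSystemSolution hy).congr_ae ?_⟩
  · filter_upwards [hK f, (h.tendsto_ae_weight S.toIsIncreasingDiffeo).eventually hfy]
      with x hKx hfx
    rw [hKx, hfx]
  · filter_upwards [h.ae_weight_iff.1 (hJ g), S.eq_r] with x hJx hrx hx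
    rw [hJx hx, hrx hx, Complex.real_smul, Complex.real_smul]
    push_cast
    ring

lemma mapsTo_graph_Tmax (S : IsLiouvilleSymmetry a b p q r A A₁ φ φ' ψ C)
    (h : IsCoefficients a b p q r) (hK : IsWeightedComposition A φ K)
    (hJ : IsWeightedComposition (fun x ↦ C * φ' x / A x) φ J) :
    MapsTo (K.prodMap J) (Tmax a b p q r).graph (Tmax a b p q r).graph :=
  fun _ hz ↦ (mem_graph_Tmax h _ _).2 (S.tauRel_map h hK hJ ((mem_graph_Tmax h _ _).1 hz))

lemma mapsTo_graph_Tmin0 (S : IsLiouvilleSymmetry a b p q r A A₁ φ φ' ψ C)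
    (h : IsCoefficients a b p q r) (hK : IsWeightedComposition A φ K)
    (hJ : IsWeightedComposition (fun x ↦ C * φ' x / A x) φ J) :
    MapsTo (K.prodMap J) (Tmin0 a b p q r).graph (Tmin0 a b p q r).graph := fun _ hz ↦
  have hz' := (mem_graph_Tmin0 h _ _).1 hz
  (mem_graph_Tmin0 h _ _).2 ⟨S.tauRel_map h hK hJ hz'.1,
    hK.apply_mem_compactlySupported h S.toIsIncreasingDiffeo hz'.2⟩

theorem kInvariant (S : IsLiouvilleSymmetry a b p q r A A₁ φ φ' ψ C)
    (h : IsCoefficients a b p q r) (hK : IsWeightedComposition A φ K) :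
    KInvariant K (Tmin0 a b p q r) ∧ KInvariant K (Tmin a b p q r) ∧
      KInvariant K (Tmax a b p q r) := by
  obtain ⟨J, hJ⟩ := S.exists_isWeightedComposition_dual h
  obtain ⟨K', hK'⟩ := S.symm.exists_isWeightedComposition h
  obtain ⟨J', hJ'⟩ := S.symm.exists_isWeightedComposition_dual h
  have hKK' : K * K' = 1 := hK.mul_eq_one h S.toIsIncreasingDiffeo hK' fun x hx ↦ by
    rw [S.invOn.1 hx, mul_inv_cancel₀ (S.A_ne_zero x hx)]
  have hK'K : K' * K = 1 := hK'.mul_eq_one h S.symm.toIsIncreasingDiffeo hK fun x hx ↦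
    inv_mul_cancel₀ (S.A_ne_zero _ (S.mapsTo_inv hx))
  have hKJ : ContinuousLinearMap.adjoint K * J = 1 :=
    hK.adjoint_mul_eq_one h S.toIsIncreasingDiffeo S.eq_r hJ fun x hx ↦
      mul_div_cancel₀ _ (S.A_ne_zero x hx)
  have hdense := h.dense_domain_Tmin0
  have hmax : (Tmax a b p q r).IsClosable := isClosable_Tmax h hdense
  have hle : Tmin0 a b p q r ≤ Tmax a b p q r := LinearPMap.domRestrict_le
  have hmin0 : (Tmin0 a b p q r).IsClosable := hmax.leIsClosable hle
  have hT := S.mapsTo_graph_Tmin0 h hK hJ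
  have hT' := S.symm.mapsTo_graph_Tmin0 h hK' hJ'
  exact ⟨kInvariant_of_mapsTo_graph hK'K hKK' hKJ hdense hmin0 hT hT',
    kInvariant_of_mapsTo_graph hK'K hKK' hKJ (hdense.mono (LinearPMap.le_closure _).1)
      hmin0.closureIsClosable (mapsTo_graph_closure hmin0 hT) (mapsTo_graph_closure hmin0 hT'),
    kInvariant_of_mapsTo_graph hK'K hKK' hKJ (hdense.mono hle.1) hmax
      (S.mapsTo_graph_Tmax h hK hJ) (S.symm.mapsTo_graph_Tmax h hK' hJ')⟩

end IsLiouvilleSymmetry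

end Symmetry

section Endpoints

variable {a b : EReal} {p q r A A₁ φ : ℝ → ℝ} {C : ℝ}

lemma openI_subset_closedI : openI a b ⊆ closedI a b := fun _ hx ↦ ⟨hx.1.le, hx.2.le⟩

lemma ordConnected_closedI : (closedI a b).OrdConnected :=
  ⟨fun _ hx _ hy _ hz ↦ ⟨hx.1.trans (mod_cast hz.1), le_trans (mod_cast hz.2) hy.2⟩⟩

namespace FixesEndpoints

lemma exists_lt (hfix : FixesEndpoints a b φ) (hφ : ContinuousOn φ (closedI a b)) {x₀ y : ℝ}
    (hx₀ : x₀ ∈ openI a b) (hy : a < y) : ∃ x ∈ openI a b, x < x₀ ∧ φ x < y := by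
  induction a with
  | bot =>
    obtain ⟨x, hxy, hx⟩ := (((hfix.2.1 rfl).eventually_lt_atBot y).and
      (eventually_lt_atBot x₀)).exists
    exact ⟨x, ⟨EReal.bot_lt_coe x, lt_trans (mod_cast hx) hx₀.2⟩, hx, hxy⟩
  | coe a =>
    have hsub : Ioo a x₀ ⊆ openI (a : EReal) b := fun x hx ↦
      ⟨mod_cast hx.1, lt_trans (mod_cast hx.2) hx₀.2⟩
    have hlim : Tendsto φ (𝓝[Ioo a x₀] a) (𝓝 (φ a)) :=
      (hφ a ⟨le_rfl, (hx₀.1.trans hx₀.2).le⟩).mono (hsub.trans openI_subset_closedI)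
    rw [hfix.1 a (.inl rfl)] at hlim
    have : (𝓝[Ioo a x₀] a).NeBot := left_nhdsWithin_Ioo_neBot (mod_cast hx₀.1)
    obtain ⟨x, hxy, hx⟩ := ((hlim.eventually_lt_const (mod_cast hy)).and
      eventually_mem_nhdsWithin).exists
    exact ⟨x, hsub hx, hx.2, hxy⟩
  | top => exact absurd hy not_top_lt

lemma exists_gt (hfix : FixesEndpoints a b φ) (hφ : ContinuousOn φ (closedI a b)) {x₀ y : ℝ}
    (hx₀ : x₀ ∈ openI a b) (hy : (y : EReal) < b) : ∃ x ∈ openI a b, x₀ < x ∧ y < φ x := by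
  induction b with
  | top =>
    obtain ⟨x, hxy, hx⟩ := (((hfix.2.2 rfl).eventually_gt_atTop y).and
      (eventually_gt_atTop x₀)).exists
    exact ⟨x, ⟨hx₀.1.trans (mod_cast hx), EReal.coe_lt_top x⟩, hx, hxy⟩
  | coe b =>
    have hsub : Ioo x₀ b ⊆ openI a (b : EReal) := fun x hx ↦
      ⟨hx₀.1.trans (mod_cast hx.1), mod_cast hx.2⟩
    have hlim : Tendsto φ (𝓝[Ioo x₀ b] b) (𝓝 (φ b)) :=
      (hφ b ⟨(hx₀.1.trans hx₀.2).le, le_rfl⟩).mono (hsub.trans openI_subset_closedI)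
    rw [hfix.1 b (.inr rfl)] at hlim
    have : (𝓝[Ioo x₀ b] b).NeBot := right_nhdsWithin_Ioo_neBot (mod_cast hx₀.2)
    obtain ⟨x, hxy, hx⟩ := ((hlim.eventually_const_lt (mod_cast hy)).and
      eventually_mem_nhdsWithin).exists
    exact ⟨x, hsub hx, hx.1, hxy⟩
  | bot => exact absurd hy not_lt_bot

lemma mapsTo_openI (hfix : FixesEndpoints a b φ) (hmono : StrictMonoOn φ (closedI a b)) :
    MapsTo φ (openI a b) (openI a b) := by
  intro x hx
  have hab := (hx.1.trans hx.2).le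
  constructor
  · induction a with
    | bot => exact EReal.bot_lt_coe _
    | coe a =>
      have hlt : φ a < φ x := hmono ⟨le_rfl, hab⟩ (openI_subset_closedI hx) (mod_cast hx.1)
      exact mod_cast hfix.1 a (.inl rfl) ▸ hlt
    | top => exact absurd hx.1 not_top_lt
  · induction b with
    | top => exact EReal.coe_lt_top _
    | coe b =>
      have hlt : φ x < φ b := hmono (openI_subset_closedI hx) ⟨hab, le_rfl⟩ (mod_cast hx.2)
      exact mod_cast hfix.1 b (.inr rfl) ▸ hlt
    | bot => exact absurd hx.2 not_lt_bot

lemma surjOn_openI (hfix : FixesEndpoints a b φ) (hφ : ContinuousOn φ (closedI a b)) :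
    SurjOn φ (openI a b) (openI a b) := by
  intro y hy
  obtain ⟨c, hc, -, hcy⟩ := hfix.exists_lt hφ hy hy.1
  obtain ⟨d, hd, -, hdy⟩ := hfix.exists_gt hφ hy hy.2
  exact ((ordConnected_openI a b).isPreconnected.image φ (hφ.mono openI_subset_closedI)).Icc_subset
    (mem_image_of_mem φ hc) (mem_image_of_mem φ hd) ⟨hcy.le, hdy.le⟩

lemma not_strictAntiOn (hfix : FixesEndpoints a b φ) (hab : a < b)
    (hφ : ContinuousOn φ (closedI a b)) : ¬StrictAntiOn φ (closedI a b) := by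
  intro hanti
  have hanti := hanti.mono openI_subset_closedI
  obtain ⟨x₀, hx₀⟩ : ∃ x₀, x₀ ∈ openI a b := EReal.lt_iff_exists_real_btwn.1 hab
  rcases lt_or_ge a (φ x₀ : EReal) with h | h
  · obtain ⟨x, hx, hxx₀, hφx⟩ := hfix.exists_lt hφ hx₀ h
    exact (hφx.trans (hanti hx hx₀ hxx₀)).false
  · obtain ⟨x, hx, hxx₀, hφx⟩ := hfix.exists_gt hφ hx₀ (h.trans_lt hab)
    exact (hφx.trans (hanti hx₀ hx hxx₀)).false

end FixesEndpoints

namespace IsTransformation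

lemma derivWithin_pos (T : IsTransformation a b p A A₁ φ) (hab : a < b) :
    ∀ x ∈ closedI a b, 0 < derivWithin φ (closedI a b) x := by
  have hconv : Convex ℝ (closedI a b) := ordConnected_closedI.convex
  have hderiv : ∀ x ∈ closedI a b,
      HasDerivWithinAt φ (derivWithin φ (closedI a b) x) (closedI a b) x :=
    fun x hx ↦ (T.contDiffOn.differentiableOn two_ne_zero x hx).hasDerivWithinAt
  refine (hasDerivWithinAt_forall_lt_or_forall_gt_of_forall_ne hconv hderiv
    T.deriv_ne_zero).resolve_left fun hneg ↦ T.fixes.not_strictAntiOn hab T.contDiffOn.continuousOn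
      (strictAntiOn_of_hasDerivWithinAt_neg hconv T.contDiffOn.continuousOn
        (fun x hx ↦ (hderiv x (interior_subset hx)).mono interior_subset)
        fun x hx ↦ hneg x (interior_subset hx))

lemma strictMonoOn (T : IsTransformation a b p A A₁ φ) (hab : a < b) :
    StrictMonoOn φ (closedI a b) :=
  strictMonoOn_of_hasDerivWithinAt_pos ordConnected_closedI.convex T.contDiffOn.continuousOn
    (fun x hx ↦ ((T.contDiffOn.differentiableOn two_ne_zero x
      (interior_subset hx)).hasDerivWithinAt).mono interior_subset)
    fun x hx ↦ T.derivWithin_pos hab x (interior_subset hx)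

theorem isIncreasingDiffeo (T : IsTransformation a b p A A₁ φ) (hab : a < b) :
    IsIncreasingDiffeo (openI a b) φ (deriv φ) (phiInv a b φ) := by
  have hopen := isOpen_openI a b
  have hsurj := T.fixes.surjOn_openI T.contDiffOn.continuousOn
  have hcontDiff : ContDiffOn ℝ 2 φ (openI a b) := T.contDiffOn.mono openI_subset_closedI
  exact
    { isOpen := hopen
      ordConnected := ordConnected_openI a b
      mapsTo := T.fixes.mapsTo_openI (T.strictMonoOn hab)
      mapsTo_inv := hsurj.mapsTo_invFunOn
      invOn := ⟨((T.strictMonoOn hab).mono openI_subset_closedI).injOn.leftInvOn_invFunOn,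
        hsurj.rightInvOn_invFunOn⟩
      hasDerivAt := fun x hx ↦ ((hcontDiff.contDiffAt (hopen.mem_nhds hx)).differentiableAt
        two_ne_zero).hasDerivAt
      deriv_pos := fun x hx ↦ by
        rw [← derivWithin_of_mem_nhds (mem_of_superset (hopen.mem_nhds hx) openI_subset_closedI)]
        exact T.derivWithin_pos hab x (openI_subset_closedI hx)
      continuousOn_deriv := hcontDiff.continuousOn_deriv_of_isOpen hopen one_le_two }

theorem isSystemSymmetry (T : IsTransformation a b p A A₁ φ) (h : IsCoefficients a b p q r)
    (E : FunctionalEquations a b p q r A A₁ φ C) :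
    IsSystemSymmetry (openI a b) (fun x ↦ 1 / p x) q A A₁ φ (deriv φ) (phiInv a b φ) := by
  have D := T.isIncreasingDiffeo h.lt
  have hp := ae_restrict_openI_iff.1 h.p_pos
  have hA : ACLoc (openI a b) A := T.ac_A.mono openI_subset_closedI
  have hA₁ : ACLoc (openI a b) A₁ := T.ac_A₁.mono openI_subset_closedI
  refine ⟨D, hA, hA₁, T.A_ne_zero, ?_, ?_, ?_⟩
  · filter_upwards [ae_restrict_openI_iff.1 T.quasiDeriv, hp,
      ae_restrict_openI_iff.1 hA.ae_differentiableAt_of_finiteDimensional] with x hA₁x hpx hdiff hx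
    refine (hdiff hx).hasDerivAt.congr_deriv ?_
    rw [hA₁x hx, smul_eq_mul, one_div, inv_mul_cancel_left₀ (hpx hx).ne']
  · filter_upwards [D.ae_comp (ae_restrict_openI_iff.1 E.eq_q),
      ae_restrict_openI_iff.1 hA₁.ae_differentiableAt_of_finiteDimensional] with x hqx hdiff hx
    have hAx := T.A_ne_zero x hx
    have hφ' := (D.deriv_pos x hx).ne'
    refine (hdiff hx).hasDerivAt.congr_deriv ?_
    rw [hqx hx, D.invOn.1 hx]
    field_simp
    ring
  · filter_upwards [D.ae_comp (ae_restrict_openI_iff.1 E.eq_p), hp] with x hpφx hpx hx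
    have hAx := T.A_ne_zero x hx
    have hφ' := (D.deriv_pos x hx).ne'
    have hpx := (hpx hx).ne'
    rw [hpφx hx, D.invOn.1 hx]
    field_simp

theorem isLiouvilleSymmetry (T : IsTransformation a b p A A₁ φ) (h : IsCoefficients a b p q r)
    (hC : 0 < C) (E : FunctionalEquations a b p q r A A₁ φ C) :
    IsLiouvilleSymmetry a b p q r A A₁ φ (deriv φ) (phiInv a b φ) C where
  toIsSystemSymmetry := T.isSystemSymmetry h E
  C_pos := hC
  eq_r := by
    have D := T.isIncreasingDiffeo h.lt
    filter_upwards [D.ae_comp (ae_restrict_openI_iff.1 E.eq_r)] with x hrx hx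
    rw [hrx hx, D.invOn.1 hx]
  bddAbove := T.bdd
  bddAbove_inv := T.bdd_inv

end IsTransformation

end Endpoints

end SturmLiouville

end

open SturmLiouville in
theorem mainTheorem4_general {a b : EReal} {p q r A A₁ φ φ' ψ : ℝ → ℝ} {C : ℝ}
    (h : IsCoefficients a b p q r) (S : IsLiouvilleSymmetry a b p q r A A₁ φ φ' ψ C) :
    (∃! K : L2 a b r →L[ℂ] L2 a b r, IsWeightedComposition A φ K) ∧
    ∀ K : L2 a b r →L[ℂ] L2 a b r, IsWeightedComposition A φ K →
      KInvariant K (Tmin0 a b p q r) ∧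
      KInvariant K (Tmin a b p q r) ∧
      KInvariant K (Tmax a b p q r) := by
  obtain ⟨K, hK⟩ := S.exists_isWeightedComposition h
  exact ⟨⟨K, hK, fun _ hK' ↦ hK'.unique hK⟩, fun _ hK ↦ S.kInvariant h hK⟩

open SturmLiouville in
theorem mainTheorem4 (a b : EReal) (p q r A A₁ φ : ℝ → ℝ) (C : ℝ)
    (hcoeff : IsCoefficients a b p q r) (hC : 0 < C)
    (htrans : IsTransformation a b p A A₁ φ)
    (heq : FunctionalEquations a b p q r A A₁ φ C) :
    (∃! K : L2 a b r →L[ℂ] L2 a b r, IsWeightedComposition A φ K) ∧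
    ∀ K : L2 a b r →L[ℂ] L2 a b r, IsWeightedComposition A φ K →
      KInvariant K (Tmin0 a b p q r) ∧
      KInvariant K (Tmin a b p q r) ∧
      KInvariant K (Tmax a b p q r) :=
  mainTheorem4_general hcoeff (htrans.isLiouvilleSymmetry hcoeff hC heq)
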